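/- Let $H$ be a complex Hilbert space (inner products are linear in the second variable), let $\mathcal B(H)$ be the algebra of bounded operators on $H$, and write $|x\rangle\langle y|$ for the operator $z\mapsto\langle y,z\rangle x$. Let $(T_t)_{t\ge 0}$ be a quantum Markov semigroup (QMS) on $\mathcal B(H)$, that is, a family of $\sigma$-weakly continuous, completely positive linear maps on $\mathcal B(H)$ with $T_0=\mathrm{id}$, $T_{t+s}=T_tT_s$, $T_t(1)=1$, and $t\mapsto T_t(A)$ $\sigma$-weakly continuous on $[0,\infty)$ for every $A\in\mathcal B(H)$. Let $L$ be its generator: $D(L)$ is the set of $A\in\mathcal B(H)$ for which $\frac1t(T_t(A)-A)$ converges $\sigma$-weakly as $t\to0^+$, and $L(A)$ is the limit. Let $\mathcal A$ be the domain algebra of $L$, i.e. the largest $*$-subalgebra of $\mathcal B(H)$ contained in $D(L)$. For a nonzero positive finite-rank operator $T=\sum_{s=1}^m t_s'\,|k_s'\rangle\langle k_s'|$ with $m\ge 1$, $t_s'>0$ and $(k_s')_{s=1}^m$ orthonormal, put $t=\sum_{s=1}^m t_s'$ and $k_s=\sqrt t\,k_s'$; a vector $h$ of the form $h=\sum_{s=1}^m\|k_s\|^{-2}k_s$,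 for some such decomposition of $T$, is called an associate vector for $T$. Suppose that $T\in D(L)$ is a nonzero positive finite-rank operator and that $h$ is an associate vector for $T$ such that $|Th\rangle\langle Th|\in D(L)$. Let $U=\{x\in H:\ |x\rangle\langle Th|\in\mathcal A\}$, a linear subspace of $H$ that is invariant under $\mathcal A$. Then there exist a Hilbert space $K$, a unital $*$-representation $\pi:\mathcal A\to\mathcal B(K)$ (a unital norm-continuous $*$-homomorphism), and linear maps $G:U\to H$ and $V:U\to K$ such that $$\langle u,L(A)w\rangle=\langle Vu,\pi(A)Vw\rangle_K+\langle u,GAw\rangle+\langle GA^*u,w\rangle$$ for all $u,w\in U$ and all $A\in\mathcal A$. -/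

import Mathlib

open Filter Topology
open scoped NNReal InnerProductSpace CStarAlgebra

universe u

noncomputable section

namespace QMS

variable {H : Type u} [NormedAddCommGroup H] [InnerProductSpace ℂ H]

/-- Square-summable sequences of vectors. -/
abbrev SqSummable (H : Type u) [NormedAddCommGroup H] : Type u :=
  {x : ℕ → H // Summable fun n => ‖x n‖ ^ 2}

/-- The functional `A ↦ ∑ₙ ⟪xₙ, A yₙ⟫` for square-summable sequences `x`, `y`. These are exactly the
functionals `A ↦ tr (A ρ)` with `ρ` of trace class, that is, the predual of the bounded operators. -/
def normalFunctional (p : SqSummable H × SqSummable H) (A : H →L[ℂ] H) : ℂ :=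
  ∑' n, ⟪p.1.1 n, A (p.2.1 n)⟫_ℂ

/-- The `σ`-weak topology on the bounded operators: the coarsest topology for which all the
functionals of the predual are continuous. -/
@[reducible]
def sigmaWeak (H : Type u) [NormedAddCommGroup H] [InnerProductSpace ℂ H] :
    TopologicalSpace (H →L[ℂ] H) :=
  TopologicalSpace.induced (fun A p => normalFunctional p A) Pi.topologicalSpace

/-- `f` converges to `B` in the `σ`-weak topology along `l`. -/
def TendstoSigmaWeak {ι : Type*} (f : ι → H →L[ℂ] H) (l : Filter ι) (B : H →L[ℂ] H) : Prop :=
  Tendsto f l (@nhds _ (sigmaWeak H) B)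

lemma tendstoSigmaWeak_iff {ι : Type*} {f : ι → H →L[ℂ] H} {l : Filter ι} {B : H →L[ℂ] H} :
    TendstoSigmaWeak f l B ↔
      ∀ p, Tendsto (fun i => normalFunctional p (f i)) l (𝓝 (normalFunctional p B)) := by
  unfold TendstoSigmaWeak sigmaWeak
  rw [@nhds_induced _ _ Pi.topologicalSpace, tendsto_comap_iff, tendsto_pi_nhds]
  rfl

lemma summable_inner (p : SqSummable H × SqSummable H) (A : H →L[ℂ] H) :
    Summable fun n => ⟪p.1.1 n, A (p.2.1 n)⟫_ℂ := by
  refine Summable.of_norm_bounded (g := fun n => ‖A‖ * (‖p.1.1 n‖ ^ 2 + ‖p.2.1 n‖ ^ 2))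
    ((p.1.2.add p.2.2).mul_left _) fun n => ?_
  calc ‖⟪p.1.1 n, A (p.2.1 n)⟫_ℂ‖ ≤ ‖p.1.1 n‖ * ‖A (p.2.1 n)‖ := norm_inner_le_norm _ _
    _ ≤ ‖p.1.1 n‖ * (‖A‖ * ‖p.2.1 n‖) := by gcongr; exact A.le_opNorm _
    _ = ‖A‖ * (‖p.1.1 n‖ * ‖p.2.1 n‖) := by ring
    _ ≤ ‖A‖ * (‖p.1.1 n‖ ^ 2 + ‖p.2.1 n‖ ^ 2) := by
      gcongr
      nlinarith [sq_nonneg (‖p.1.1 n‖ - ‖p.2.1 n‖), sq_nonneg ‖p.1.1 n‖, sq_nonneg ‖p.2.1 n‖]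

lemma normalFunctional_add (p : SqSummable H × SqSummable H) (A B : H →L[ℂ] H) :
    normalFunctional p (A + B) = normalFunctional p A + normalFunctional p B := by
  simp only [normalFunctional, add_apply, inner_add_right]
  exact (summable_inner p A).tsum_add (summable_inner p B)

lemma normalFunctional_smul (p : SqSummable H × SqSummable H) (c : ℂ) (A : H →L[ℂ] H) :
    normalFunctional p (c • A) = c * normalFunctional p A := by
  simp only [normalFunctional, smul_apply, inner_smul_right]
  exact tsum_mul_left

/-- The sequence `x, 0, 0, …`. -/
def single (x : H) : SqSummable H :=
  ⟨fun n => if n = 0 then x else 0,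
    summable_of_ne_finset_zero (s := {0}) fun n hn => by
      have : n ≠ 0 := by simpa using hn
      simp [this]⟩

lemma normalFunctional_single (x y : H) (A : H →L[ℂ] H) :
    normalFunctional (single x, single y) A = ⟪x, A y⟫_ℂ := by
  unfold normalFunctional
  rw [tsum_eq_single 0]
  · simp [single]
  · intro n hn
    simp [single, hn]

lemma TendstoSigmaWeak.unique {ι : Type*} {f : ι → H →L[ℂ] H} {l : Filter ι} [l.NeBot]
    {B C : H →L[ℂ] H} (hB : TendstoSigmaWeak f l B) (hC : TendstoSigmaWeak f l C) : B = C := by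
  rw [tendstoSigmaWeak_iff] at hB hC
  ext y
  refine ext_inner_left ℂ fun x => ?_
  rw [← normalFunctional_single, ← normalFunctional_single]
  exact tendsto_nhds_unique (hB _) (hC _)

lemma TendstoSigmaWeak.add {ι : Type*} {f g : ι → H →L[ℂ] H} {l : Filter ι} {B C : H →L[ℂ] H}
    (hB : TendstoSigmaWeak f l B) (hC : TendstoSigmaWeak g l C) :
    TendstoSigmaWeak (fun i => f i + g i) l (B + C) := by
  rw [tendstoSigmaWeak_iff] at *
  intro p
  simpa only [normalFunctional_add] using (hB p).add (hC p)

lemma TendstoSigmaWeak.smul {ι : Type*} {f : ι → H →L[ℂ] H} {l : Filter ι} {B : H →L[ℂ] H}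
    (c : ℂ) (hB : TendstoSigmaWeak f l B) : TendstoSigmaWeak (fun i => c • f i) l (c • B) := by
  rw [tendstoSigmaWeak_iff] at *
  intro p
  simpa only [normalFunctional_smul] using (hB p).const_mul c

variable [CompleteSpace H]

/-- A quantum Markov semigroup on the algebra of all bounded operators of `H`. -/
structure QuantumMarkovSemigroup (H : Type u) [NormedAddCommGroup H] [InnerProductSpace ℂ H]
    [CompleteSpace H] where
  /-- the completely positive linear map at time `t` -/
  map : ℝ≥0 → ((H →L[ℂ] H) →CP (H →L[ℂ] H))
  continuous_map : ∀ t, Continuous[sigmaWeak H, sigmaWeak H] (map t)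
  map_zero : ∀ A, map 0 A = A
  map_add : ∀ t s A, map (t + s) A = map t (map s A)
  continuous_time : ∀ A, Continuous[NNReal.instTopologicalSpace, sigmaWeak H] fun t => map t A
  map_one : ∀ t, map t 1 = 1

/-- The difference quotient `(T_t A - A) / t`. -/
def diffQuot (S : QuantumMarkovSemigroup H) (A : H →L[ℂ] H) (t : ℝ≥0) : H →L[ℂ] H :=
  ((t : ℝ) : ℂ)⁻¹ • (S.map t A - A)

lemma diffQuot_add (S : QuantumMarkovSemigroup H) (A B : H →L[ℂ] H) :
    diffQuot S (A + B) = fun t => diffQuot S A t + diffQuot S B t := by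
  funext t
  simp only [diffQuot, _root_.map_add, ← smul_add]
  congr 1
  abel

lemma diffQuot_smul (S : QuantumMarkovSemigroup H) (c : ℂ) (A : H →L[ℂ] H) :
    diffQuot S (c • A) = fun t => c • diffQuot S A t := by
  funext t
  simp only [diffQuot, _root_.map_smul, ← smul_sub]
  exact smul_comm _ _ _

/-- `A` lies in the domain of the generator and `B` is the value of the generator at `A`. In `ℝ≥0`
the filter `𝓝[≠] 0` is that of `t → 0` through `t > 0`. -/
def IsGeneratorAt (S : QuantumMarkovSemigroup H) (A B : H →L[ℂ] H) : Prop :=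
  TendstoSigmaWeak (diffQuot S A) (𝓝[≠] 0) B

lemma IsGeneratorAt.unique {S : QuantumMarkovSemigroup H} {A B C : H →L[ℂ] H}
    (hB : IsGeneratorAt S A B) (hC : IsGeneratorAt S A C) : B = C :=
  TendstoSigmaWeak.unique hB hC

lemma IsGeneratorAt.add {S : QuantumMarkovSemigroup H} {A A' B B' : H →L[ℂ] H}
    (h : IsGeneratorAt S A B) (h' : IsGeneratorAt S A' B') :
    IsGeneratorAt S (A + A') (B + B') := by
  unfold IsGeneratorAt
  rw [diffQuot_add]
  exact TendstoSigmaWeak.add h h'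

lemma IsGeneratorAt.smul {S : QuantumMarkovSemigroup H} {A B : H →L[ℂ] H} (c : ℂ)
    (h : IsGeneratorAt S A B) : IsGeneratorAt S (c • A) (c • B) := by
  unfold IsGeneratorAt
  rw [diffQuot_smul]
  exact TendstoSigmaWeak.smul c h

/-- The domain of the generator: all `A` for which `(T_t A - A) / t` converges `σ`-weakly as
`t → 0`. -/
def generatorDomain (S : QuantumMarkovSemigroup H) : Submodule ℂ (H →L[ℂ] H) where
  carrier := {A | ∃ B, IsGeneratorAt S A B}
  add_mem' := fun ⟨_, h⟩ ⟨_, h'⟩ => ⟨_, h.add h'⟩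
  zero_mem' := ⟨(0 : ℂ) • 0, by
    have : diffQuot S 0 = fun _ => 0 := by funext t; simp [diffQuot]
    unfold IsGeneratorAt
    rw [this, tendstoSigmaWeak_iff]
    intro p
    simp⟩
  smul_mem' := fun c _ ⟨_, h⟩ => ⟨_, h.smul c⟩

/-- The generator `L` of the semigroup, an unbounded operator with domain `generatorDomain S`. -/
def generator (S : QuantumMarkovSemigroup H) : (H →L[ℂ] H) →ₗ.[ℂ] (H →L[ℂ] H) where
  domain := generatorDomain S
  toFun :=
    { toFun := fun A => A.2.choose
      map_add' := fun A B =>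
        IsGeneratorAt.unique (A + B).2.choose_spec (A.2.choose_spec.add B.2.choose_spec)
      map_smul' := fun c A =>
        IsGeneratorAt.unique (c • A).2.choose_spec (A.2.choose_spec.smul c) }

lemma generator_spec (S : QuantumMarkovSemigroup H) (A : (generator S).domain) :
    IsGeneratorAt S A (generator S A) :=
  A.2.choose_spec

/-- The domain algebra: the largest `*`-subalgebra of the domain of the generator, as the supremum of
all `*`-subalgebras contained in the domain. -/
def domainAlgebra (S : QuantumMarkovSemigroup H) : StarSubalgebra ℂ (H →L[ℂ] H) :=
  sSup {B | (B : Set (H →L[ℂ] H)) ⊆ (generator S).domain}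

/-- `h` is an associate vector of the (nonzero) positive finite-rank operator `T`: writing
`T = ∑ₛ t'ₛ |k'ₛ⟩⟨k'ₛ|` with `k'` orthonormal and `t'ₛ > 0`, and putting `t = ∑ₛ t'ₛ`,
`kₛ = √t k'ₛ`, one has `h = ∑ₛ ‖kₛ‖⁻² kₛ`. -/
def IsAssociateVector (T : H →L[ℂ] H) (h : H) : Prop :=
  ∃ (m : ℕ) (t' : Fin m → ℝ) (k' k : Fin m → H),
    0 < m ∧ (∀ s, 0 < t' s) ∧ Orthonormal ℂ k' ∧
    T = ∑ s, (t' s : ℂ) • InnerProductSpace.rankOne ℂ (k' s) (k' s) ∧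
    (∀ s, k s = (√(∑ r, t' r) : ℂ) • k' s) ∧
    h = ∑ s, ((‖k s‖ ^ 2)⁻¹ : ℂ) • k s

/-- The subspace `{x | |x⟩⟨y| ∈ 𝒜}`. -/
def rankOneSubspace (𝒜 : StarSubalgebra ℂ (H →L[ℂ] H)) (y : H) : Submodule ℂ H where
  carrier := {x | InnerProductSpace.rankOne ℂ x y ∈ 𝒜}
  add_mem' := fun {a b} ha hb => by
    simpa only [Set.mem_ofPred_eq, _root_.map_add, add_apply] using add_mem ha hb
  zero_mem' := by
    simpa only [Set.mem_ofPred_eq, _root_.map_zero, zero_apply] using zero_mem 𝒜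
  smul_mem' := fun c x hx => by
    simpa only [Set.mem_ofPred_eq, _root_.map_smul, smul_apply] using SMulMemClass.smul_mem c hx

/-- The subspace `{x | |x⟩⟨y| ∈ 𝒜}` is invariant under `𝒜`: this is `A` acting on it. -/
def act {𝒜 : StarSubalgebra ℂ (H →L[ℂ] H)} {y : H} (A : 𝒜) (x : rankOneSubspace 𝒜 y) :
    rankOneSubspace 𝒜 y :=
  ⟨(A : H →L[ℂ] H) x, by
    have e : InnerProductSpace.rankOne ℂ ((A : H →L[ℂ] H) x) y
        = (A : H →L[ℂ] H) * InnerProductSpace.rankOne ℂ (x : H) y := by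
      ext z; simp
    change InnerProductSpace.rankOne ℂ ((A : H →L[ℂ] H) x) y ∈ 𝒜
    rw [e]
    exact mul_mem A.2 x.2⟩

end QMS

end

/-! Normalise `T h` to a unit vector `e` and let the drift be `G v = L(|v⟩⟨e|) e - ½ Re⟪e, L(|e⟩⟨e|)
e⟫ v`. The claim is then that the remaining form `⟪u, L(A) w⟫ - ⟪u, G A w⟫ - ⟪G A* u, w⟫` is `⟪V u,
π(A) V w⟫`. By a GNS construction on `𝒜 ⊗ U` (`exists_dilation`) it suffices that this kernel is
hermitian, positive definite and bounded under left multiplication.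

These properties are closed under pointwise limits, so they may be checked with `L` replaced by
`(T_t - id) / t`. For a unital completely positive `φ = V* π(·) V`, the form belonging to `φ - id`
is exactly `⟪W u, π(A) W w⟫` with `W u = V u - π(|u⟩⟨e|) V e` (`exists_dilation_jumpForm_sub`). The
limit `t → 0` exists because `A`, `|e⟩⟨e|`, `|A w⟩⟨e|` and `|A* u⟩⟨e|` all lie in `D(L)`.

Separately, the supremum of the `*`-subalgebras inside `D(L)` must itself be shown to lie in `D(L)`.
The key is that `A ∈ D(L)` iff `‖T_t A - A‖ = O(t)` (`mem_domain_iff_hasLipschitzOrbit`). The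
failure of multiplicativity `T_t(A* A) - T_t(A)* T_t(A)` obeys Cauchy–Schwarz, so the elements of
`D(L)` for which it is `O(t)`, together with that of their adjoint, form one `*`-algebra containing
all the others (`domainAlgebra_le`). -/

noncomputable section

namespace QMS

/-! ### GNS dilation of positive definite kernels on a `*`-algebra. -/

section Dilation

open scoped TensorProduct ComplexConjugate

/-- A representation of a `*`-algebra by operators that are adjointable and bounded for a positive
semidefinite form passes to the Hilbert space completion of that form. -/
theorem exists_completion_representation {𝒜 : Type*} [NormedRing 𝒜] [StarRing 𝒜] [Algebra ℂ 𝒜]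
    [StarModule ℂ 𝒜]
    {E : Type u} [AddCommGroup E] [Module ℂ E] (c : PreInnerProductSpace.Core ℂ E)
    (ρ : 𝒜 →ₐ[ℂ] Module.End ℂ E)
    (hadj : ∀ a x y, c.inner (ρ a x) y = c.inner x (ρ (star a) y))
    (hbdd : ∀ a x, (c.inner (ρ a x) (ρ a x)).re ≤ ‖a‖ ^ 2 * (c.inner x x).re) :
    ∃ (K : Type u) (_ : NormedAddCommGroup K) (_ : InnerProductSpace ℂ K) (_ : CompleteSpace K)
      (π : 𝒜 →⋆ₐ[ℂ] (K →L[ℂ] K)) (ι : E →ₗ[ℂ] K),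
      (∀ x y, ⟪ι x, ι y⟫_ℂ = c.inner x y) ∧ (∀ a x, π a (ι x) = ι (ρ a x)) ∧
      ∀ a, ‖π a‖ ≤ ‖a‖ := by
  let _ : SeminormedAddCommGroup E := InnerProductSpace.Core.toSeminormedAddCommGroup (c := c)
  let _ : InnerProductSpace ℂ E := InnerProductSpace.ofCore c
  have hinner : ∀ x y : E, ⟪x, y⟫_ℂ = c.inner x y := fun _ _ => rfl
  have hnorm : ∀ (a : 𝒜) (x : E), ‖ρ a x‖ ≤ ‖a‖ * ‖x‖ := fun a x => by
    rw [← sq_le_sq₀ (by positivity) (by positivity), mul_pow, ← inner_self_eq_norm_sq (𝕜 := ℂ) (ρ a x),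
      ← inner_self_eq_norm_sq (𝕜 := ℂ) x]
    exact hbdd a x
  let r : 𝒜 → E →L[ℂ] E := fun a => (ρ a).mkContinuous ‖a‖ (hnorm a)
  have hr : ∀ a x, r a x = ρ a x := fun _ _ => rfl
  have hcoe : ∀ a (x : E), (r a).completion (x : UniformSpace.Completion E)
      = ((ρ a x : E) : UniformSpace.Completion E) := fun a x => by
    rw [ContinuousLinearMap.completion_apply_coe, hr]
  let π : 𝒜 →⋆ₐ[ℂ] (UniformSpace.Completion E →L[ℂ] UniformSpace.Completion E) :=
    { toFun := fun a => (r a).completion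
      map_one' := by
        ext x
        induction x using UniformSpace.Completion.induction_on with
        | hp => apply isClosed_eq <;> fun_prop
        | ih x => simp [hcoe]
      map_mul' := fun a b => by
        ext x
        induction x using UniformSpace.Completion.induction_on with
        | hp => apply isClosed_eq <;> fun_prop
        | ih x => simp [hcoe]
      map_zero' := by
        ext x
        induction x using UniformSpace.Completion.induction_on with
        | hp => apply isClosed_eq <;> fun_prop
        | ih x => simp [hcoe, UniformSpace.Completion.coe_zero]
      map_add' := fun a b => by
        ext x
        induction x using UniformSpace.Completion.induction_on with
        | hp => apply isClosed_eq <;> fun_prop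
        | ih x => simp [hcoe, UniformSpace.Completion.coe_add]
      commutes' := fun z => by
        ext x
        induction x using UniformSpace.Completion.induction_on with
        | hp => apply isClosed_eq <;> fun_prop
        | ih x => simp [hcoe, Algebra.algebraMap_eq_smul_one]
      map_star' := fun a => by
        refine (ContinuousLinearMap.eq_adjoint_iff _ _).mpr fun x y => ?_
        induction x, y using UniformSpace.Completion.induction_on₂ with
        | hp => apply isClosed_eq <;> fun_prop
        | ih x y =>
          rw [hcoe, hcoe, UniformSpace.Completion.inner_coe, UniformSpace.Completion.inner_coe,
            hinner, hinner, hadj, star_star] }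
  refine ⟨UniformSpace.Completion E, inferInstance, inferInstance, inferInstance, π,
    (UniformSpace.Completion.toComplₗᵢ (𝕜 := ℂ) (E := E)).toLinearMap, fun x y => ?_,
    fun a x => hcoe a x, fun a => ?_⟩
  · exact UniformSpace.Completion.inner_coe x y
  · refine ContinuousLinearMap.opNorm_le_bound _ (norm_nonneg _) fun x => ?_
    induction x using UniformSpace.Completion.induction_on with
    | hp => apply isClosed_le <;> fun_prop
    | ih x =>
      change ‖(r a).completion (x : UniformSpace.Completion E)‖ ≤ _
      rw [hcoe, UniformSpace.Completion.norm_coe, UniformSpace.Completion.norm_coe]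
      exact hnorm a x

section Kernel

variable {𝒜 : Type u} [NormedRing 𝒜] [StarRing 𝒜] [Algebra ℂ 𝒜] [StarModule ℂ 𝒜]
  {U : Type u} [AddCommGroup U] [Module ℂ U]

/-- The sesquilinear form on `𝒜 ⊗ U` with `(a ⊗ u, b ⊗ w) ↦ β (a* b) u w`. -/
def kernelForm (β : 𝒜 →ₗ[ℂ] U →ₗ⋆[ℂ] U →ₗ[ℂ] ℂ) : 𝒜 ⊗[ℂ] U →ₗ⋆[ℂ] 𝒜 ⊗[ℂ] U →ₗ[ℂ] ℂ :=
  TensorProduct.lift <| LinearMap.mk₂'ₛₗ (starRingEnd ℂ) (starRingEnd ℂ)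
    (fun a u => TensorProduct.lift <| LinearMap.mk₂ ℂ (fun b w => β (star a * b) u w)
      (by intros; simp [mul_add]) (by intros; simp) (by intros; simp) (by intros; simp))
    (by intros; ext; simp [add_mul]) (by intros; ext; simp)
    (by intros; ext; simp) (by intros; ext; simp)

lemma kernelForm_tmul (β : 𝒜 →ₗ[ℂ] U →ₗ⋆[ℂ] U →ₗ[ℂ] ℂ) (a b : 𝒜) (u w : U) :
    kernelForm β (a ⊗ₜ u) (b ⊗ₜ w) = β (star a * b) u w := rfl

/-- The dilation of a positive definite bounded kernel on a `*`-algebra. -/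
theorem exists_dilation (β : 𝒜 →ₗ[ℂ] U →ₗ⋆[ℂ] U →ₗ[ℂ] ℂ)
    (hherm : ∀ a u w, β (star a) u w = conj (β a w u))
    (hpos : ∀ s : Finset (𝒜 × U), 0 ≤ (∑ q ∈ s, ∑ p ∈ s, β (star p.1 * q.1) p.2 q.2).re)
    (hbdd : ∀ (a : 𝒜) (s : Finset (𝒜 × U)),
      (∑ q ∈ s, ∑ p ∈ s, β (star (a * p.1) * (a * q.1)) p.2 q.2).re
        ≤ ‖a‖ ^ 2 * (∑ q ∈ s, ∑ p ∈ s, β (star p.1 * q.1) p.2 q.2).re) :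
    ∃ (K : Type u) (_ : NormedAddCommGroup K) (_ : InnerProductSpace ℂ K) (_ : CompleteSpace K)
      (π : 𝒜 →⋆ₐ[ℂ] (K →L[ℂ] K)) (V : U →ₗ[ℂ] K),
      (∀ a, ‖π a‖ ≤ ‖a‖) ∧ ∀ a u w, β a u w = ⟪V u, π a (V w)⟫_ℂ := by
  let ρ : 𝒜 →ₐ[ℂ] Module.End ℂ (𝒜 ⊗[ℂ] U) :=
    (Module.End.rTensorAlgHom ℂ 𝒜 U).comp (Algebra.lmul ℂ 𝒜)
  have hρ : ∀ a b u, ρ a (b ⊗ₜ u) = (a * b) ⊗ₜ u := fun _ _ _ => rfl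
  let c : PreInnerProductSpace.Core ℂ (𝒜 ⊗[ℂ] U) :=
    { inner := fun x y => kernelForm β x y
      conj_inner_symm := fun x y => by
        induction x using TensorProduct.induction_on with
        | zero => simp
        | add x₁ x₂ h₁ h₂ => simp [h₁, h₂]
        | tmul a u =>
          induction y using TensorProduct.induction_on with
          | zero => simp
          | add y₁ y₂ h₁ h₂ => simp [h₁, h₂]
          | tmul b w => rw [kernelForm_tmul, kernelForm_tmul, ← hherm]; simp
      re_inner_nonneg := fun x => by
        obtain ⟨s, rfl⟩ := TensorProduct.exists_finset x
        simpa [kernelForm_tmul] using hpos s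
      add_left := by simp
      smul_left := by simp }
  obtain ⟨K, i₁, i₂, i₃, π, ι, h₁, h₂, h₃⟩ := exists_completion_representation c ρ
    (fun a x y => by
      change kernelForm β _ _ = kernelForm β _ _
      induction x using TensorProduct.induction_on with
      | zero => simp
      | add x₁ x₂ h₁ h₂ => simp [h₁, h₂]
      | tmul b u =>
        induction y using TensorProduct.induction_on with
        | zero => simp
        | add y₁ y₂ h₁ h₂ => simp only [map_add, h₁, h₂]
        | tmul d w => rw [hρ, hρ, kernelForm_tmul, kernelForm_tmul]; simp [mul_assoc])
    (fun a x => by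
      change (kernelForm β _ _).re ≤ _ * (kernelForm β _ _).re
      obtain ⟨s, rfl⟩ := TensorProduct.exists_finset x
      simpa only [map_sum, LinearMap.sum_apply, hρ, kernelForm_tmul] using hbdd a s)
  -- `V u` is the class of `1 ⊗ u`, so pairing it with `a ⊗ w` returns `β a u w`.
  refine ⟨K, i₁, i₂, i₃, π, ι ∘ₗ TensorProduct.mk ℂ 𝒜 U 1, h₃, fun a u w => ?_⟩
  simp only [LinearMap.comp_apply, h₂, h₁, TensorProduct.mk_apply, hρ]
  change _ = kernelForm β _ _
  simp [kernelForm_tmul]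

end Kernel

end Dilation

/-! ### Stinespring dilation of completely positive maps. -/

section Stinespring

open scoped ComplexOrder ComplexConjugate

variable {H : Type u} [NormedAddCommGroup H] [InnerProductSpace ℂ H] [CompleteSpace H]

/-- Positive matrices are generated additively by the `N* N`, for which the sum is `∑ₖ ‖∑ᵢ N k i
xᵢ‖²`. -/
lemma sum_inner_nonneg_of_cstarMatrix_nonneg {n : Type*} [Fintype n]
    {M : CStarMatrix n n (H →L[ℂ] H)} (hM : 0 ≤ M) (x : n → H) :
    0 ≤ ∑ j, ∑ i, ⟪x i, M i j (x j)⟫_ℂ := by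
  rw [StarOrderedRing.nonneg_iff] at hM
  induction hM using AddSubmonoid.closure_induction with
  | zero => simp [CStarMatrix.zero_apply]
  | add M N _ _ h₁ h₂ =>
    simpa only [CStarMatrix.add_apply, add_apply, inner_add_right, Finset.sum_add_distrib]
      using add_nonneg h₁ h₂
  | mem M hM =>
    obtain ⟨N, rfl⟩ := hM
    have key : ∑ j, ∑ i, ⟪x i, (star N * N) i j (x j)⟫_ℂ
        = ∑ k, ⟪∑ i, N k i (x i), ∑ j, N k j (x j)⟫_ℂ := by
      simp only [CStarMatrix.mul_apply, CStarMatrix.star_apply, sum_apply,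
        mul_apply_eq_comp, inner_sum, sum_inner,
        ContinuousLinearMap.star_eq_adjoint, ContinuousLinearMap.adjoint_inner_right]
      rw [Finset.sum_congr rfl fun j _ => Finset.sum_comm, Finset.sum_comm]
    rw [key]
    refine Finset.sum_nonneg fun k _ => ?_
    rw [inner_self_eq_norm_sq_to_K]
    positivity

/-- The matrix `(Aᵢ* Aⱼ)` equals `R* R`, where `R` has the `Aⱼ` in one row and zeros elsewhere, so
complete positivity applies to it. -/
lemma sum_inner_map_nonneg (φ : (H →L[ℂ] H) →CP (H →L[ℂ] H)) {n : Type*} [Fintype n]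
    (A : n → H →L[ℂ] H) (x : n → H) :
    0 ≤ ∑ j, ∑ i, ⟪x i, φ (star (A i) * A j) (x j)⟫_ℂ := by
  classical
  rcases isEmpty_or_nonempty n with hn | ⟨⟨i₀⟩⟩
  · simp
  let R : CStarMatrix n n (H →L[ℂ] H) := CStarMatrix.ofMatrix fun k j => if k = i₀ then A j else 0
  have hR : ∀ i j, (star R * R) i j = star (A i) * A j := fun i j => by
    rw [CStarMatrix.mul_apply, Finset.sum_eq_single i₀]
    · change star (if i₀ = i₀ then A i else 0) * (if i₀ = i₀ then A j else 0) = _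
      simp
    · intro k _ hk
      change star (if k = i₀ then A i else 0) * (if k = i₀ then A j else 0) = _
      simp [hk]
    · simp
  have := sum_inner_nonneg_of_cstarMatrix_nonneg (φ.map_cstarMatrix_nonneg (star R * R)
    (star_mul_self_nonneg R)) x
  simpa only [CStarMatrix.map_apply, hR] using this

/-- The **Stinespring dilation** of a completely positive map. -/
theorem exists_stinespring (φ : (H →L[ℂ] H) →CP (H →L[ℂ] H)) :
    ∃ (K : Type u) (_ : NormedAddCommGroup K) (_ : InnerProductSpace ℂ K) (_ : CompleteSpace K)
      (π : (H →L[ℂ] H) →⋆ₐ[ℂ] (K →L[ℂ] K)) (V : H →ₗ[ℂ] K),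
      (∀ A, ‖π A‖ ≤ ‖A‖) ∧ ∀ A u w, ⟪u, φ A w⟫_ℂ = ⟪V u, π A (V w)⟫_ℂ := by
  let β : (H →L[ℂ] H) →ₗ[ℂ] H →ₗ⋆[ℂ] H →ₗ[ℂ] ℂ :=
    { toFun := fun A => LinearMap.mk₂'ₛₗ (starRingEnd ℂ) (RingHom.id ℂ) (fun u w => ⟪u, φ A w⟫_ℂ)
        (by simp) (by simp [mul_comm]) (by simp) (by simp)
      map_add' := fun A B => by ext; simp
      map_smul' := fun c A => by ext; simp }
  have hβ : ∀ A u w, β A u w = ⟪u, φ A w⟫_ℂ := fun _ _ _ => rfl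
  have hpos : ∀ (s : Finset ((H →L[ℂ] H) × H)) (C : H →L[ℂ] H),
      0 ≤ (∑ q ∈ s, ∑ p ∈ s, β (star (C * p.1) * (C * q.1)) p.2 q.2).re := fun s C => by
    have := sum_inner_map_nonneg φ (fun i : s => C * i.1.1) fun i => i.1.2
    rw [Finset.sum_coe_sort s fun q : (H →L[ℂ] H) × H =>
      ∑ i : s, ⟪i.1.2, φ (star (C * i.1.1) * (C * q.1)) q.2⟫_ℂ] at this
    rw [Finset.sum_congr rfl fun q _ => Finset.sum_coe_sort s fun p : (H →L[ℂ] H) × H =>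
      ⟪p.2, φ (star (C * p.1) * (C * q.1)) q.2⟫_ℂ] at this
    exact (Complex.le_def.mp this).1
  have hstar : ∀ A, φ (star A) = star (φ A) := fun A => map_star (PositiveLinearMap.ofClass φ) A
  have := exists_dilation β (fun A u w => by
      rw [hβ, hβ, hstar, ContinuousLinearMap.star_eq_adjoint,
        ContinuousLinearMap.adjoint_inner_right, inner_conj_symm])
    (fun s => by simpa using hpos s 1)
    (fun A s => by
      -- Writing `‖A‖² - A* A = C* C`, the bound becomes positivity with `C` inserted.
      obtain ⟨C, hC⟩ := CStarAlgebra.nonneg_iff_eq_star_mul_self.mp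
        (sub_nonneg.mpr (CStarAlgebra.star_mul_le_algebraMap_norm_sq (a := A)))
      have h := hpos s C
      have e : ∀ p q : (H →L[ℂ] H) × H, star (C * p.1) * (C * q.1)
          = ((‖A‖ ^ 2 : ℝ) : ℂ) • (star p.1 * q.1) - star (A * p.1) * (A * q.1) := fun p q => by
        have : star (C * p.1) * (C * q.1) = star p.1 * (star C * C) * q.1 := by
          simp [mul_assoc]
        rw [this, ← hC, Algebra.algebraMap_eq_smul_one]
        simp only [mul_sub, sub_mul, mul_assoc, star_mul, Algebra.mul_smul_comm, smul_mul_assoc,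
          one_mul, Complex.coe_smul]
      simp only [e, map_sub, map_smul, LinearMap.sub_apply, LinearMap.smul_apply,
        Finset.sum_sub_distrib, ← Finset.mul_sum, Complex.sub_re, smul_eq_mul,
        Complex.re_ofReal_mul] at h
      linarith)
  exact this

end Stinespring

/-! ### Unital completely positive maps: contractivity, multiplicative defect, stability of vector
states. -/

section UnitalCP

open scoped ComplexConjugate
open ContinuousLinearMap (adjoint)

variable {H : Type u} [NormedAddCommGroup H] [InnerProductSpace ℂ H] [CompleteSpace H]

/-- The Stinespring dilation of a unital completely positive map, with a bounded `V`. -/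
theorem exists_stinespring_of_map_one (φ : (H →L[ℂ] H) →CP (H →L[ℂ] H)) (hφ : φ 1 = 1) :
    ∃ (K : Type u) (_ : NormedAddCommGroup K) (_ : InnerProductSpace ℂ K) (_ : CompleteSpace K)
      (π : (H →L[ℂ] H) →⋆ₐ[ℂ] (K →L[ℂ] K)) (V : H →L[ℂ] K),
      (∀ A, ‖π A‖ ≤ ‖A‖) ∧ (∀ x, ‖V x‖ = ‖x‖) ∧ ∀ A x y, ⟪x, φ A y⟫_ℂ = ⟪V x, π A (V y)⟫_ℂ := by
  obtain ⟨K, i₁, i₂, i₃, π, V, hπ, hV⟩ := exists_stinespring φ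
  -- Unitality makes `V` isometric: evaluate the dilation at `A = 1`.
  have hnorm : ∀ x, ‖V x‖ = ‖x‖ := fun x => by
    have h := hV 1 x x
    rw [hφ, map_one] at h
    change ⟪x, x⟫_ℂ = ⟪V x, V x⟫_ℂ at h
    rw [inner_self_eq_norm_sq_to_K, inner_self_eq_norm_sq_to_K] at h
    have h' : ‖x‖ ^ 2 = ‖V x‖ ^ 2 := by exact_mod_cast h
    exact ((sq_eq_sq₀ (norm_nonneg _) (norm_nonneg _)).mp h').symm
  refine ⟨K, i₁, i₂, i₃, π, V.mkContinuous 1 fun x => by rw [hnorm, one_mul], hπ, hnorm, hV⟩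

lemma inner_representation_left {K : Type*} [NormedAddCommGroup K] [InnerProductSpace ℂ K]
    [CompleteSpace K] (π : (H →L[ℂ] H) →⋆ₐ[ℂ] (K →L[ℂ] K)) (A : H →L[ℂ] H) (x y : K) :
    ⟪π A x, y⟫_ℂ = ⟪x, π (star A) y⟫_ℂ := by
  have h : π (star A) = adjoint (π A) := map_star π A
  rw [h, ContinuousLinearMap.adjoint_inner_right]

lemma norm_map_le (φ : (H →L[ℂ] H) →CP (H →L[ℂ] H)) (hφ : φ 1 = 1) (A : H →L[ℂ] H) :
    ‖φ A‖ ≤ ‖A‖ := by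
  obtain ⟨K, i₁, i₂, i₃, π, V, hπ, hV, h⟩ := exists_stinespring_of_map_one φ hφ
  refine ContinuousLinearMap.opNorm_le_of_re_inner_le (norm_nonneg _) fun x y hx hy => ?_
  rw [← inner_conj_symm, RCLike.conj_re, h]
  calc _ ≤ ‖⟪V y, π A (V x)⟫_ℂ‖ := RCLike.re_le_norm _
    _ ≤ ‖V y‖ * (‖π A‖ * ‖V x‖) := (norm_inner_le_norm _ _).trans <| by
      gcongr; exact (π A).le_opNorm _
    _ ≤ 1 * (‖A‖ * 1) := by rw [hV, hV, hx, hy]; gcongr; exact hπ A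
    _ = ‖A‖ := by ring

lemma map_star_eq (φ : (H →L[ℂ] H) →CP (H →L[ℂ] H)) (A : H →L[ℂ] H) :
    φ (star A) = star (φ A) :=
  map_star (PositiveLinearMap.ofClass φ) A

/-- The failure of multiplicativity of `φ`, as an operator-valued sesquilinear form. -/
def defect (φ : (H →L[ℂ] H) →CP (H →L[ℂ] H)) (A B : H →L[ℂ] H) : H →L[ℂ] H :=
  φ (star A * B) - star (φ A) * φ B

/-- The seminorm of the positive semidefinite form `defect φ`. -/
def defectNorm (φ : (H →L[ℂ] H) →CP (H →L[ℂ] H)) (A : H →L[ℂ] H) : ℝ := √‖defect φ A A‖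

/-- With `R A = π(A) V - V φ(A)`, the relations `V* V = 1` and `V* π(·) V = φ` give the
factorization. Cauchy–Schwarz, the triangle inequality and a Leibniz-type estimate for `defectNorm`
then become statements about operator norms. -/
lemma exists_defect_factorization (φ : (H →L[ℂ] H) →CP (H →L[ℂ] H)) (hφ : φ 1 = 1) :
    ∃ (K : Type u) (_ : NormedAddCommGroup K) (_ : InnerProductSpace ℂ K) (_ : CompleteSpace K)
      (R : (H →L[ℂ] H) →ₗ[ℂ] (H →L[ℂ] K)),
      (∀ A B, defect φ A B = adjoint (R A) ∘L R B) ∧ (∀ A, ‖R A‖ = defectNorm φ A) ∧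
      (∀ A B, ‖R (A * B)‖ ≤ ‖R A‖ * ‖B‖ + 3 * ‖A‖ * ‖R B‖) := by
  obtain ⟨K, i₁, i₂, i₃, π, V, hπ, hV, hφV⟩ := exists_stinespring_of_map_one φ hφ
  let R : (H →L[ℂ] H) →ₗ[ℂ] (H →L[ℂ] K) :=
    { toFun := fun A => π A ∘L V - V ∘L φ A
      map_add' := fun A B => by ext; simp; abel
      map_smul' := fun c A => by ext; simp [smul_sub] }
  have hR : ∀ A x, R A x = π A (V x) - V (φ A x) := fun _ _ => rfl
  have hVV : ∀ x y, ⟪V x, V y⟫_ℂ = ⟪x, y⟫_ℂ :=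
    fun x y => (⟨V.toLinearMap, hV⟩ : H →ₗᵢ[ℂ] K).inner_map_map x y
  have hπstar := inner_representation_left π
  have hφstar : ∀ A x y, ⟪φ A x, y⟫_ℂ = ⟪x, φ (star A) y⟫_ℂ := fun A x y => by
    rw [map_star_eq, ContinuousLinearMap.star_eq_adjoint, ContinuousLinearMap.adjoint_inner_right]
  have hdef : ∀ A B, defect φ A B = adjoint (R A) ∘L R B := fun A B => by
    ext y
    refine ext_inner_left ℂ fun x => ?_
    have e₁ : ⟪π A (V x), V (φ B y)⟫_ℂ = ⟪φ A x, φ B y⟫_ℂ := by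
      rw [hπstar, ← hφV, hφstar]
    have e₂ : ⟪V (φ A x), π B (V y)⟫_ℂ = ⟪φ A x, φ B y⟫_ℂ := by rw [← hφV]
    rw [ContinuousLinearMap.comp_apply, ContinuousLinearMap.adjoint_inner_right, hR, hR, defect,
      sub_apply, inner_sub_right, inner_sub_left, inner_sub_right, inner_sub_right, e₁, e₂, hVV,
      hφV, mul_apply_eq_comp, ← map_star_eq, ← hφstar, hπstar, map_mul, mul_apply_eq_comp]
    ring
  have hV1 : ‖V‖ ≤ 1 := V.opNorm_le_bound zero_le_one fun x => by rw [hV, one_mul]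
  refine ⟨K, i₁, i₂, i₃, R, hdef, fun A => ?_, fun A B => ?_⟩
  · rw [defectNorm, hdef, ContinuousLinearMap.norm_adjoint_comp_self,
      Real.sqrt_mul_self (norm_nonneg _)]
  · have hRstar : ‖R (star A)‖ ≤ 2 * ‖A‖ := by
      refine ContinuousLinearMap.opNorm_le_bound _ (by positivity) fun x => ?_
      rw [hR]
      have e₁ : ‖π (star A) (V x)‖ ≤ ‖A‖ * ‖x‖ := by
        rw [← norm_star A, ← hV x]
        exact ((π (star A)).le_opNorm _).trans (by gcongr; exact hπ _)
      have e₂ : ‖V (φ (star A) x)‖ ≤ ‖A‖ * ‖x‖ := by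
        rw [hV, ← norm_star A]
        exact ((φ (star A)).le_opNorm _).trans (by gcongr; exact norm_map_le φ hφ _)
      linarith [norm_sub_le (π (star A) (V x)) (V (φ (star A) x))]
    -- A twisted Leibniz rule whose correction is `V` applied to the defect of `A*` and `B`. The
    -- constant `3` is `1` from the second term plus `2` from `‖R (A*)‖ ≤ 2 ‖A‖`.
    have e : R (A * B) = R A ∘L φ B + π A ∘L R B - V ∘L (adjoint (R (star A)) ∘L R B) := by
      rw [← hdef]
      ext x
      simp [hR, defect, map_star_eq]
    rw [e]
    have b₁ : ‖R A ∘L φ B‖ ≤ ‖R A‖ * ‖B‖ := (ContinuousLinearMap.opNorm_comp_le _ _).trans <| by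
      gcongr; exact norm_map_le φ hφ _
    have b₂ : ‖π A ∘L R B‖ ≤ ‖A‖ * ‖R B‖ := (ContinuousLinearMap.opNorm_comp_le _ _).trans <| by
      gcongr; exact hπ _
    have b₃ : ‖V ∘L (adjoint (R (star A)) ∘L R B)‖ ≤ 1 * ((2 * ‖A‖) * ‖R B‖) :=
      (ContinuousLinearMap.opNorm_comp_le _ _).trans <| by
        gcongr
        refine (ContinuousLinearMap.opNorm_comp_le _ _).trans ?_
        gcongr
        rwa [LinearIsometryEquiv.norm_map]
    linarith [norm_sub_le (R A ∘L φ B + π A ∘L R B) (V ∘L (adjoint (R (star A)) ∘L R B)),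
      norm_add_le (R A ∘L φ B) (π A ∘L R B)]

lemma norm_defect_le (φ : (H →L[ℂ] H) →CP (H →L[ℂ] H)) (hφ : φ 1 = 1) (A B : H →L[ℂ] H) :
    ‖defect φ A B‖ ≤ defectNorm φ A * defectNorm φ B := by
  obtain ⟨K, i₁, i₂, i₃, R, h₁, h₂, -⟩ := exists_defect_factorization φ hφ
  rw [h₁, ← h₂, ← h₂, ← LinearIsometryEquiv.norm_map adjoint (R A)]
  exact ContinuousLinearMap.opNorm_comp_le _ _

lemma defectNorm_add_le (φ : (H →L[ℂ] H) →CP (H →L[ℂ] H)) (hφ : φ 1 = 1) (A B : H →L[ℂ] H) :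
    defectNorm φ (A + B) ≤ defectNorm φ A + defectNorm φ B := by
  obtain ⟨K, i₁, i₂, i₃, R, -, h₂, -⟩ := exists_defect_factorization φ hφ
  rw [← h₂, ← h₂, ← h₂, map_add]
  exact norm_add_le _ _

lemma defectNorm_mul_le (φ : (H →L[ℂ] H) →CP (H →L[ℂ] H)) (hφ : φ 1 = 1) (A B : H →L[ℂ] H) :
    defectNorm φ (A * B) ≤ defectNorm φ A * ‖B‖ + 3 * ‖A‖ * defectNorm φ B := by
  obtain ⟨K, i₁, i₂, i₃, R, -, h₂, h₃⟩ := exists_defect_factorization φ hφ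
  rw [← h₂, ← h₂, ← h₂]
  exact h₃ A B

lemma defectNorm_algebraMap (φ : (H →L[ℂ] H) →CP (H →L[ℂ] H)) (hφ : φ 1 = 1) (c : ℂ) :
    defectNorm φ (algebraMap ℂ _ c) = 0 := by
  simp [defectNorm, defect, Algebra.algebraMap_eq_smul_one, hφ]

/-- If a unital completely positive map nearly fixes the rank one projection onto the unit vector
`x`, then it nearly preserves the vector state of `x`, uniformly on bounded sets. -/
lemma norm_inner_map_sub_le (φ : (H →L[ℂ] H) →CP (H →L[ℂ] H)) (hφ : φ 1 = 1) {x : H}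
    (hx : ‖x‖ = 1) {δ : ℝ} (hδ : ‖⟪x, φ (InnerProductSpace.rankOne ℂ x x) x⟫_ℂ - 1‖ ≤ δ ^ 2)
    (hδ0 : 0 ≤ δ) (X : H →L[ℂ] H) :
    ‖⟪x, φ X x⟫_ℂ - ⟪x, X x⟫_ℂ‖ ≤ (2 * δ + δ ^ 2) * ‖X‖ := by
  obtain ⟨K, i₁, i₂, i₃, π, V, hπ, hV, hφV⟩ := exists_stinespring_of_map_one φ hφ
  have hπstar := inner_representation_left π
  set P : H →L[ℂ] H := InnerProductSpace.rankOne ℂ x x with hP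
  have hPs : star P = P := by simp [hP, ContinuousLinearMap.star_eq_adjoint]
  have hPXP : P * X * P = ⟪x, X x⟫_ℂ • P := by
    ext y; simp [hP, smul_smul, mul_comm]
  have hPP : P * P = P := by
    ext y; simp [hP, inner_self_eq_norm_sq_to_K, hx]
  -- Replace `V x` by its projection `p`: the squared distance is `1 - ⟪x, φ(P) x⟫`, and at `p` the
  -- state is explicit because `P X P = ⟪x, X x⟫ P`.
  set p := π P (V x) with hp
  have hpx : ⟪p, p⟫_ℂ = ⟪x, φ P x⟫_ℂ := by
    rw [hp, hπstar, hφV, hPs, ← mul_apply_eq_comp, ← map_mul, hPP]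
  have hpV : ⟪p, V x⟫_ℂ = ⟪x, φ P x⟫_ℂ := by rw [hp, hπstar, hφV, hPs]
  have hVp : ⟪V x, p⟫_ℂ = ⟪x, φ P x⟫_ℂ := by rw [hp, hφV]
  have hVxx : ⟪V x, V x⟫_ℂ = 1 := by rw [inner_self_eq_norm_sq_to_K, hV, hx]; simp
  have hρ : ‖V x - p‖ ≤ δ := by
    have e : ⟪V x - p, V x - p⟫_ℂ = 1 - ⟪x, φ P x⟫_ℂ := by
      rw [inner_sub_left, inner_sub_right, inner_sub_right, hpx, hpV, hVp, hVxx]; ring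
    rw [inner_self_eq_norm_sq_to_K] at e
    have e' := congrArg norm e
    rw [norm_pow, RCLike.norm_ofReal, abs_norm] at e'
    exact (sq_le_sq₀ (norm_nonneg _) hδ0).mp (e'.trans_le (by rwa [norm_sub_rev]))
  have hp1 : ‖p‖ ≤ 1 := by
    have : ‖P‖ ≤ 1 := by simp [hP, InnerProductSpace.norm_rankOne, hx]
    calc ‖p‖ ≤ ‖π P‖ * ‖V x‖ := (π P).le_opNorm _
      _ ≤ 1 * 1 := by gcongr; exacts [(hπ P).trans this, by rw [hV, hx]]
      _ = 1 := by ring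
  have hmain : ⟪p, π X p⟫_ℂ = ⟪x, X x⟫_ℂ * ⟪x, φ P x⟫_ℂ := by
    have : ⟪p, π X p⟫_ℂ = ⟪V x, π (P * X * P) (V x)⟫_ℂ := by
      rw [hp, hπstar, hPs, map_mul, map_mul]; rfl
    rw [this, hPXP, map_smul, smul_apply, inner_smul_right, hφV]
  have hVx1 : ‖V x‖ = 1 := by rw [hV, hx]
  have hXx : ‖⟪x, X x⟫_ℂ‖ ≤ ‖X‖ := by
    calc ‖⟪x, X x⟫_ℂ‖ ≤ ‖x‖ * ‖X x‖ := norm_inner_le_norm _ _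
      _ ≤ ‖x‖ * (‖X‖ * ‖x‖) := by gcongr; exact X.le_opNorm _
      _ = ‖X‖ := by rw [hx]; ring
  have e : ⟪x, φ X x⟫_ℂ - ⟪x, X x⟫_ℂ = ⟪V x - p, π X (V x)⟫_ℂ + ⟪p, π X (V x - p)⟫_ℂ
      + ⟪x, X x⟫_ℂ * (⟪x, φ P x⟫_ℂ - 1) := by
    rw [mul_sub, ← hmain, map_sub, inner_sub_left, inner_sub_right, hφV]; ring
  have b₁ : ‖⟪V x - p, π X (V x)⟫_ℂ‖ ≤ δ * (‖X‖ * 1) := by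
    refine (norm_inner_le_norm _ _).trans ?_
    gcongr
    refine ((π X).le_opNorm _).trans ?_
    rw [hVx1]; gcongr; exact hπ X
  have b₂ : ‖⟪p, π X (V x - p)⟫_ℂ‖ ≤ 1 * (‖X‖ * δ) := by
    refine (norm_inner_le_norm _ _).trans ?_
    gcongr
    refine ((π X).le_opNorm _).trans ?_
    gcongr; exact hπ X
  have b₃ : ‖⟪x, X x⟫_ℂ * (⟪x, φ P x⟫_ℂ - 1)‖ ≤ ‖X‖ * δ ^ 2 := by
    rw [norm_mul]; gcongr
  rw [e]
  refine (norm_add₃_le).trans ?_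
  linarith

end UnitalCP

/-! ### The domain of the generator consists of the operators with Lipschitz orbit. -/

section LipschitzOrbit

variable {H : Type u} [NormedAddCommGroup H] [InnerProductSpace ℂ H]

lemma TendstoSigmaWeak.inner {ι : Type*} {f : ι → H →L[ℂ] H} {l : Filter ι} {B : H →L[ℂ] H}
    (h : TendstoSigmaWeak f l B) (x y : H) :
    Tendsto (fun i => ⟪x, f i y⟫_ℂ) l (𝓝 ⟪x, B y⟫_ℂ) := by
  simpa only [normalFunctional_single] using tendstoSigmaWeak_iff.mp h (single x, single y)

variable [CompleteSpace H]

/-- A bounded family of operators with convergent quadratic forms converges `σ`-weakly. -/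
lemma exists_tendstoSigmaWeak {ι : Type*} {l : Filter ι} [l.NeBot] {f : ι → H →L[ℂ] H} {C : ℝ}
    (hC : ∀ i, ‖f i‖ ≤ C) (hf : ∀ x, ∃ z, Tendsto (fun i => ⟪f i x, x⟫_ℂ) l (𝓝 z)) :
    ∃ B, TendstoSigmaWeak f l B := by
  have hf' : ∀ x y, ∃ z, Tendsto (fun i => ⟪f i x, y⟫_ℂ) l (𝓝 z) := fun y x => by
    obtain ⟨z₁, h₁⟩ := hf (x + y)
    obtain ⟨z₂, h₂⟩ := hf (x - y)
    obtain ⟨z₃, h₃⟩ := hf (x + Complex.I • y)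
    obtain ⟨z₄, h₄⟩ := hf (x - Complex.I • y)
    refine ⟨_, Tendsto.congr (fun i => (inner_map_polarization (f i).toLinearMap x y).symm)
      ((((h₁.sub h₂).add (h₃.const_mul Complex.I)).sub (h₄.const_mul Complex.I)).div_const 4)⟩
  choose b hb using hf'
  have hbound : ∀ x y i, ‖⟪f i x, y⟫_ℂ‖ ≤ C * ‖x‖ * ‖y‖ := fun x y i =>
    calc ‖⟪f i x, y⟫_ℂ‖ ≤ ‖f i x‖ * ‖y‖ := norm_inner_le_norm _ _
      _ ≤ C * ‖x‖ * ‖y‖ := by gcongr; exact (f i).le_of_opNorm_le (hC i) x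
  let b' : H →ₗ⋆[ℂ] H →ₗ[ℂ] ℂ := LinearMap.mk₂'ₛₗ (starRingEnd ℂ) (RingHom.id ℂ) b
    (fun x x' y => tendsto_nhds_unique (hb (x + x') y) <| by
      simpa only [map_add, inner_add_left] using (hb x y).add (hb x' y))
    (fun c x y => tendsto_nhds_unique (hb (c • x) y) <| by
      simpa only [map_smul, inner_smul_left, smul_eq_mul] using (hb x y).const_mul _)
    (fun x y y' => tendsto_nhds_unique (hb x (y + y')) <| by
      simpa only [inner_add_right] using (hb x y).add (hb x y'))
    (fun c x y => tendsto_nhds_unique (hb x (c • y)) <| by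
      simpa only [inner_smul_right, smul_eq_mul, RingHom.id_apply] using (hb x y).const_mul c)
  let β := b'.mkContinuous₂ C fun x y =>
    le_of_tendsto (hb x y).norm (Eventually.of_forall fun i => hbound x y i)
  let B := InnerProductSpace.continuousLinearMapOfBilin β
  have hB : ∀ x y, Tendsto (fun i => ⟪x, f i y⟫_ℂ) l (𝓝 ⟪x, B y⟫_ℂ) := fun x y => by
    have h : ⟪B y, x⟫_ℂ = b y x := InnerProductSpace.continuousLinearMapOfBilin_apply β y x
    have h' := (Complex.continuous_conj.tendsto _).comp (hb y x)
    rw [← h] at h'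
    simpa only [Function.comp_def, inner_conj_symm] using h'
  refine ⟨B, tendstoSigmaWeak_iff.mpr fun p => ?_⟩
  -- The uniform norm bound upgrades weak convergence to `σ`-weak convergence.
  refine tendsto_tsum_of_dominated_convergence
    (bound := fun n => C * (‖p.1.1 n‖ ^ 2 + ‖p.2.1 n‖ ^ 2)) ((p.1.2.add p.2.2).mul_left C)
    (fun n => hB _ _) (Eventually.of_forall fun i n => ?_)
  have hC0 : 0 ≤ C := (norm_nonneg _).trans (hC i)
  calc ‖⟪p.1.1 n, f i (p.2.1 n)⟫_ℂ‖ ≤ C * ‖p.2.1 n‖ * ‖p.1.1 n‖ := by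
        rw [norm_inner_symm]; exact hbound _ _ _
    _ = C * (‖p.1.1 n‖ * ‖p.2.1 n‖) := by ring
    _ ≤ C * (‖p.1.1 n‖ ^ 2 + ‖p.2.1 n‖ ^ 2) := by
      gcongr
      nlinarith [sq_nonneg (‖p.1.1 n‖ - ‖p.2.1 n‖), sq_nonneg ‖p.1.1 n‖, sq_nonneg ‖p.2.1 n‖]

/-- A weakly convergent sequence of operators is bounded. -/
lemma TendstoSigmaWeak.exists_norm_le {f : ℕ → H →L[ℂ] H} {B : H →L[ℂ] H}
    (h : TendstoSigmaWeak f atTop B) : ∃ C, ∀ n, ‖f n‖ ≤ C := by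
  -- Uniform boundedness is used twice: on the functionals `⟪f n y, ·⟫` for fixed `y`, then on the
  -- operators `f n`.
  refine banach_steinhaus fun y => ?_
  obtain ⟨C, hC⟩ := banach_steinhaus (g := fun n => innerSL ℂ (f n y)) fun x => by
    obtain ⟨C, hC⟩ := (h.inner x y).norm.bddAbove_range
    refine ⟨C, fun n => ?_⟩
    rw [innerSL_apply_apply, norm_inner_symm]
    exact hC ⟨n, rfl⟩
  exact ⟨C, fun n => by simpa using hC n⟩

/-- `A` has a Lipschitz orbit under the semigroup. -/
def HasLipschitzOrbit (S : QuantumMarkovSemigroup H) (A : H →L[ℂ] H) : Prop :=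
  ∃ M : ℝ, ∀ t : ℝ≥0, ‖S.map t A - A‖ ≤ M * t

lemma norm_map_sub_eq (S : QuantumMarkovSemigroup H) (A : H →L[ℂ] H) {t : ℝ≥0} (ht : t ≠ 0) :
    ‖S.map t A - A‖ = t * ‖diffQuot S A t‖ := by
  have : (t : ℝ) ≠ 0 := by exact_mod_cast ht
  rw [diffQuot, norm_smul, norm_inv, Complex.norm_real, Real.norm_of_nonneg t.coe_nonneg]
  field_simp

lemma norm_map_sub_le_two (S : QuantumMarkovSemigroup H) (A : H →L[ℂ] H) (t : ℝ≥0) :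
    ‖S.map t A - A‖ ≤ 2 * ‖A‖ := by
  linarith [norm_sub_le (S.map t A) A, norm_map_le (S.map t) (S.map_one t) A]

/-- Near `0` the difference quotients are bounded, since otherwise a sequence `tₙ → 0` would give an
unbounded convergent sequence. Away from `0`, the bound `2 ‖A‖` suffices. -/
lemma hasLipschitzOrbit_of_mem_domain {S : QuantumMarkovSemigroup H} {A : H →L[ℂ] H}
    (hA : A ∈ (generator S).domain) : HasLipschitzOrbit S A := by
  obtain ⟨B, hB⟩ := hA
  have key : ∃ C δ : ℝ, 0 < δ ∧ ∀ t : ℝ≥0, t ≠ 0 → (t : ℝ) < δ → ‖diffQuot S A t‖ ≤ C := by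
    by_contra! hcon
    choose t ht0 ht hlarge using fun n : ℕ => hcon n (1 / ((n : ℝ) + 1)) Nat.one_div_pos_of_nat
    have hlim : Tendsto t atTop (𝓝[≠] 0) := by
      refine tendsto_nhdsWithin_iff.mpr ⟨?_, Eventually.of_forall ht0⟩
      rw [← NNReal.tendsto_coe]
      exact squeeze_zero (fun n => (t n).2) (fun n => (ht n).le) tendsto_one_div_add_atTop_nhds_zero_nat
    obtain ⟨C, hC⟩ := TendstoSigmaWeak.exists_norm_le (f := fun n => diffQuot S A (t n)) (B := B)
      (Tendsto.comp hB hlim)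
    obtain ⟨n, hn⟩ := exists_nat_gt C
    linarith [hC n, hlarge n]
  obtain ⟨C, δ, hδ, hC⟩ := key
  refine ⟨max C (2 * ‖A‖ / δ), fun t => ?_⟩
  rcases eq_or_ne t 0 with rfl | ht
  · simp [S.map_zero]
  rcases lt_or_ge (t : ℝ) δ with h | h
  · rw [norm_map_sub_eq S A ht, mul_comm]
    gcongr
    exact (hC t ht h).trans (le_max_left _ _)
  · calc ‖S.map t A - A‖ ≤ 2 * ‖A‖ := norm_map_sub_le_two S A t
      _ = 2 * ‖A‖ / δ * δ := by field_simp
      _ ≤ max C (2 * ‖A‖ / δ) * t := by gcongr; exact le_max_right _ _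

/-- The dual semigroup is strongly continuous at vector states. -/
lemma exists_norm_inner_map_sub_le (S : QuantumMarkovSemigroup H) {x : H} (hx : ‖x‖ = 1) {ε : ℝ}
    (hε : 0 < ε) : ∃ s : ℝ≥0, 0 < s ∧ ∀ r ≤ s, ∀ X : H →L[ℂ] H,
      ‖⟪x, S.map r X x⟫_ℂ - ⟪x, X x⟫_ℂ‖ ≤ ε * ‖X‖ := by
  set P : H →L[ℂ] H := InnerProductSpace.rankOne ℂ x x with hP
  have hPx : ⟪x, P x⟫_ℂ = 1 := by simp [hP, inner_self_eq_norm_sq_to_K, hx]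
  have h0 : TendstoSigmaWeak (fun t => S.map t P) (𝓝 0) (S.map 0 P) :=
    @Continuous.tendsto _ _ _ (sigmaWeak H) _ (S.continuous_time P) 0
  have hlim := h0.inner x x
  rw [S.map_zero, hPx] at hlim
  -- This makes `2δ + δ² ≤ 3δ ≤ ε`.
  set δ := min 1 (ε / 3) with hδ
  have hδ0 : 0 < δ := lt_min one_pos (by positivity)
  obtain ⟨s, hs, hs'⟩ := Metric.eventually_nhds_iff.mp
    (Metric.tendsto_nhds.mp hlim (δ ^ 2) (by positivity))
  refine ⟨⟨s / 2, by positivity⟩, by exact_mod_cast half_pos hs, fun r hr X => ?_⟩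
  have hr' : (r : ℝ) ≤ s / 2 := by exact_mod_cast hr
  have hd : dist r 0 < s := by
    rw [NNReal.dist_eq]
    simp only [NNReal.coe_zero, sub_zero, NNReal.abs_eq]
    linarith
  have := norm_inner_map_sub_le (S.map r) (S.map_one r) hx
    (by simpa [dist_eq_norm] using (hs' hd).le) hδ0.le X
  refine this.trans ?_
  gcongr
  have h1 : δ ≤ 1 := min_le_left _ _
  have h2 : δ ≤ ε / 3 := min_le_right _ _
  nlinarith

/-- Over a short time interval the orbit of `A` is nearly additive in the state of `x`. -/
lemma norm_inner_map_nsmul_sub_le (S : QuantumMarkovSemigroup H) {A : H →L[ℂ] H} {M : ℝ}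
    (hM : ∀ t : ℝ≥0, ‖S.map t A - A‖ ≤ M * t) {x : H} {ε : ℝ} (hε : 0 ≤ ε) {s : ℝ≥0}
    (hs : ∀ r ≤ s, ∀ X : H →L[ℂ] H, ‖⟪x, S.map r X x⟫_ℂ - ⟪x, X x⟫_ℂ‖ ≤ ε * ‖X‖) (t : ℝ≥0) (N : ℕ)
    (hN : N * t ≤ s) :
    ‖⟪x, (S.map (N * t) A - A) x⟫_ℂ - N * ⟪x, (S.map t A - A) x⟫_ℂ‖ ≤ N * (ε * (M * t)) := by
  induction N with
  | zero => simp [S.map_zero]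
  | succ N ih =>
    have hN' : N * t ≤ s := le_trans (by gcongr; simp) hN
    have e : S.map ((N + 1 : ℕ) * t) A - A
        = (S.map (N * t) A - A) + S.map (N * t) (S.map t A - A) := by
      rw [map_sub, ← S.map_add, Nat.cast_succ, add_mul, one_mul]
      abel
    have h₁ := ih hN'
    have h₂ : ‖⟪x, S.map (N * t) (S.map t A - A) x⟫_ℂ - ⟪x, (S.map t A - A) x⟫_ℂ‖ ≤ ε * (M * t) :=
      (hs _ hN' _).trans (by gcongr; exact hM t)
    rw [e, add_apply, inner_add_right]
    calc _ = ‖(⟪x, (S.map (N * t) A - A) x⟫_ℂ - N * ⟪x, (S.map t A - A) x⟫_ℂ)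
          + (⟪x, S.map (N * t) (S.map t A - A) x⟫_ℂ - ⟪x, (S.map t A - A) x⟫_ℂ)‖ := by
          congr 1; push_cast; ring
      _ ≤ _ := (norm_add_le _ _).trans (by rw [Nat.cast_succ (R := ℝ)]; linarith)

lemma norm_diffQuot_le (S : QuantumMarkovSemigroup H) {A : H →L[ℂ] H} {M : ℝ}
    (hM : ∀ t : ℝ≥0, ‖S.map t A - A‖ ≤ M * t) (t : ℝ≥0) : ‖diffQuot S A t‖ ≤ M := by
  rcases eq_or_ne t 0 with rfl | ht
  -- At `t = 0` the quotient is `0` by the convention `0⁻¹ = 0`; time `1` supplies `0 ≤ M`.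
  · have h1 := (norm_nonneg _).trans (hM 1)
    simpa [diffQuot] using h1
  · have h := hM t
    rw [norm_map_sub_eq S A ht, mul_comm] at h
    exact le_of_mul_le_mul_right h (by exact_mod_cast pos_iff_ne_zero.mpr ht)

/-- Divide `s = N t + r` with `r ≤ t`. Near-additivity over the `N` steps costs at most `ε M s`, and
the remainder enters twice, each time costing at most `M t ≤ ε M s`. Dividing by `s` gives `3 ε M`.
-/
lemma norm_inner_diffQuot_sub_le (S : QuantumMarkovSemigroup H) {A : H →L[ℂ] H} {M : ℝ}
    (hM : ∀ t : ℝ≥0, ‖S.map t A - A‖ ≤ M * t) {x : H} (hx : ‖x‖ = 1) {ε : ℝ} (hε : 0 ≤ ε) {s : ℝ≥0}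
    (hs0 : 0 < s)
    (hs : ∀ r ≤ s, ∀ X : H →L[ℂ] H, ‖⟪x, S.map r X x⟫_ℂ - ⟪x, X x⟫_ℂ‖ ≤ ε * ‖X‖) {t : ℝ≥0}
    (ht0 : t ≠ 0) (ht : (t : ℝ) ≤ ε * s) :
    ‖⟪x, diffQuot S A s x⟫_ℂ - ⟪x, diffQuot S A t x⟫_ℂ‖ ≤ 3 * ε * M := by
  have hM0 : 0 ≤ M := (norm_nonneg _).trans (norm_diffQuot_le S hM 0)
  have hinner : ∀ X : H →L[ℂ] H, ‖⟪x, X x⟫_ℂ‖ ≤ ‖X‖ := fun X => by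
    calc ‖⟪x, X x⟫_ℂ‖ ≤ ‖x‖ * ‖X x‖ := norm_inner_le_norm _ _
      _ ≤ ‖x‖ * (‖X‖ * ‖x‖) := by gcongr; exact X.le_opNorm _
      _ = ‖X‖ := by rw [hx]; ring
  have hq : ∀ r : ℝ≥0, r ≠ 0 → ⟪x, (S.map r A - A) x⟫_ℂ = (r : ℝ) * ⟪x, diffQuot S A r x⟫_ℂ :=
    fun r hr => by
      have : ((r : ℝ) : ℂ) ≠ 0 := by exact_mod_cast hr
      rw [diffQuot, smul_apply, inner_smul_right]
      field_simp
  set N := ⌊s / t⌋₊ with hN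
  have htpos : 0 < t := pos_iff_ne_zero.mpr ht0
  have hNs : N * t ≤ s := by
    have := Nat.floor_le (a := s / t) zero_le
    exact (le_div_iff₀ htpos).mp this
  have hNs' : s ≤ N * t + t := by
    have := (Nat.lt_floor_add_one (s / t)).le
    rw [div_le_iff₀ htpos] at this
    rwa [add_mul, one_mul] at this
  obtain ⟨r, hr⟩ := exists_add_of_le hNs
  have hrt : r ≤ t := by rw [hr] at hNs'; exact le_of_add_le_add_left hNs'
  have h₁ := norm_inner_map_nsmul_sub_le S hM hε hs t N hNs
  have h₂ : ‖⟪x, (S.map s A - S.map (N * t) A) x⟫_ℂ‖ ≤ M * t := by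
    refine (hinner _).trans ?_
    have : S.map s A - S.map (N * t) A = S.map (N * t) (S.map r A - A) := by
      rw [map_sub, ← S.map_add, ← hr]
    rw [this]
    exact (norm_map_le _ (S.map_one _) _).trans ((hM r).trans (by gcongr))
  have h₃ : ‖((r : ℝ) : ℂ) * ⟪x, diffQuot S A t x⟫_ℂ‖ ≤ t * M := by
    rw [norm_mul, Complex.norm_real, Real.norm_of_nonneg r.coe_nonneg]
    gcongr
    exact (hinner _).trans (norm_diffQuot_le S hM t)
  have hsr : ((s : ℝ) : ℂ) = N * (t : ℝ) + (r : ℝ) := by rw [hr]; push_cast; ring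
  have e : ((s : ℝ) : ℂ) * (⟪x, diffQuot S A s x⟫_ℂ - ⟪x, diffQuot S A t x⟫_ℂ)
      = ⟪x, (S.map s A - S.map (N * t) A) x⟫_ℂ
        + (⟪x, (S.map (N * t) A - A) x⟫_ℂ - N * ⟪x, (S.map t A - A) x⟫_ℂ)
        - (r : ℝ) * ⟪x, diffQuot S A t x⟫_ℂ := by
    rw [mul_sub, ← hq s hs0.ne', hq t ht0, hsr]
    simp only [sub_apply, inner_sub_right]
    ring
  have hNt : (N : ℝ) * t ≤ s := by exact_mod_cast hNs
  have hsp : (0 : ℝ) < s := by exact_mod_cast hs0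
  have hfin : (s : ℝ) * ‖⟪x, diffQuot S A s x⟫_ℂ - ⟪x, diffQuot S A t x⟫_ℂ‖ ≤ s * (3 * ε * M) := by
    have : (s : ℝ) * ‖⟪x, diffQuot S A s x⟫_ℂ - ⟪x, diffQuot S A t x⟫_ℂ‖
        = ‖((s : ℝ) : ℂ) * (⟪x, diffQuot S A s x⟫_ℂ - ⟪x, diffQuot S A t x⟫_ℂ)‖ := by
      rw [norm_mul, Complex.norm_real, Real.norm_of_nonneg s.coe_nonneg]
    rw [this, e]
    have b₁ : (N : ℝ) * (ε * (M * t)) ≤ s * (ε * M) := by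
      calc (N : ℝ) * (ε * (M * t)) = (N * t) * (ε * M) := by ring
        _ ≤ s * (ε * M) := by gcongr
    have b₂ : M * t ≤ M * (ε * s) := by gcongr
    refine (norm_sub_le _ _).trans ?_
    linarith [norm_add_le (⟪x, (S.map s A - S.map (N * t) A) x⟫_ℂ)
      (⟪x, (S.map (N * t) A - A) x⟫_ℂ - N * ⟪x, (S.map t A - A) x⟫_ℂ)]
  exact le_of_mul_le_mul_left hfin hsp

/-- Cauchy criterion: for all sufficiently small `t` the quotients are close to the one at a single
fixed time `s`. -/
lemma exists_tendsto_inner_diffQuot {S : QuantumMarkovSemigroup H} {A : H →L[ℂ] H}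
    (hA : HasLipschitzOrbit S A) {x : H} (hx : ‖x‖ = 1) :
    ∃ z, Tendsto (fun t => ⟪x, diffQuot S A t x⟫_ℂ) (𝓝[≠] 0) (𝓝 z) := by
  obtain ⟨M, hM⟩ := hA
  have hM0 : 0 ≤ M := (norm_nonneg _).trans (norm_diffQuot_le S hM 0)
  refine cauchy_map_iff_exists_tendsto.mp (Metric.cauchy_iff.mpr ⟨inferInstance, fun ε hε => ?_⟩)
  -- Two errors of `3 η M` must total less than `ε`, also when `M = 0`.
  set η := ε / (6 * M + 7) with hη
  have hη0 : 0 < η := by positivity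
  obtain ⟨s, hs0, hs⟩ := exists_norm_inner_map_sub_le S hx hη0
  have hsp : (0 : ℝ) < s := by exact_mod_cast hs0
  refine ⟨_, image_mem_map (m := fun t => ⟪x, diffQuot S A t x⟫_ℂ)
    (s := {t : ℝ≥0 | t ≠ 0 ∧ (t : ℝ) ≤ η * s}) ?_, ?_⟩
  · refine inter_mem self_mem_nhdsWithin (mem_nhdsWithin_of_mem_nhds ?_)
    have : Tendsto (fun t : ℝ≥0 => (t : ℝ)) (𝓝 0) (𝓝 0) := by
      simpa using NNReal.continuous_coe.tendsto 0
    exact this.eventually_le_const (by positivity)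
  · rintro _ ⟨t, ⟨ht0, ht⟩, rfl⟩ _ ⟨t', ⟨ht0', ht'⟩, rfl⟩
    have h := norm_inner_diffQuot_sub_le S hM hx hη0.le hs0 hs ht0 ht
    have h' := norm_inner_diffQuot_sub_le S hM hx hη0.le hs0 hs ht0' ht'
    rw [← dist_eq_norm] at h h'
    have hlt : 6 * η * M < ε := by
      have : η * (6 * M + 7) = ε := by rw [hη]; field_simp
      nlinarith
    linarith [dist_triangle_left (⟪x, diffQuot S A t x⟫_ℂ) (⟪x, diffQuot S A t' x⟫_ℂ)
      (⟪x, diffQuot S A s x⟫_ℂ)]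

theorem mem_domain_iff_hasLipschitzOrbit {S : QuantumMarkovSemigroup H} {A : H →L[ℂ] H} :
    A ∈ (generator S).domain ↔ HasLipschitzOrbit S A := by
  refine ⟨hasLipschitzOrbit_of_mem_domain, fun hA => ?_⟩
  obtain ⟨M, hM⟩ := id hA
  refine exists_tendstoSigmaWeak (norm_diffQuot_le S hM) fun x => ?_
  rcases eq_or_ne x 0 with rfl | hx
  · exact ⟨0, by simp⟩
  have hx' : (‖x‖ : ℂ) ≠ 0 := by simpa using hx
  set y : H := (‖x‖ : ℂ)⁻¹ • x with hy
  have hy1 : ‖y‖ = 1 := by rw [hy]; exact norm_smul_inv_norm hx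
  have hxy : x = (‖x‖ : ℂ) • y := by rw [hy, smul_smul, mul_inv_cancel₀ hx', one_smul]
  obtain ⟨z, hz⟩ := exists_tendsto_inner_diffQuot hA hy1
  -- Rescales from the unit vector `y` to `x`; the conjugation swaps the two slots of the inner
  -- product.
  have hz' := ((Complex.continuous_conj.tendsto _).comp hz).const_mul ((‖x‖ : ℂ) * ‖x‖)
  refine ⟨_, hz'.congr fun t => ?_⟩
  rw [Function.comp_apply, inner_conj_symm]
  conv_rhs => rw [hxy]
  simp only [map_smul, inner_smul_left, inner_smul_right, Complex.conj_ofReal]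
  ring

end LipschitzOrbit

/-! ### The domain algebra lies in the domain of the generator. -/

section DomainAlgebra

variable {H : Type u} [NormedAddCommGroup H] [InnerProductSpace ℂ H] [CompleteSpace H]

/-- The defect of the maps of the semigroup at `A` is of order `t`. -/
def HasLinearDefect (S : QuantumMarkovSemigroup H) (A : H →L[ℂ] H) : Prop :=
  ∃ M : ℝ, ∀ t : ℝ≥0, defectNorm (S.map t) A ≤ M * √t

section

variable {S : QuantumMarkovSemigroup H} {A B : H →L[ℂ] H}

lemma HasLipschitzOrbit.star (hA : HasLipschitzOrbit S A) : HasLipschitzOrbit S (star A) := by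
  obtain ⟨M, hM⟩ := hA
  refine ⟨M, fun t => ?_⟩
  rw [map_star_eq, ← star_sub, norm_star]
  exact hM t

/-- `T_t(AB) - AB` is the defect of `A*` and `B` plus two terms controlled by the orbits. By
Cauchy–Schwarz the defect is of order `√t · √t = t`. -/
lemma HasLipschitzOrbit.mul (hA : HasLipschitzOrbit S A) (hB : HasLipschitzOrbit S B)
    (hA' : HasLinearDefect S (Star.star A)) (hB' : HasLinearDefect S B) :
    HasLipschitzOrbit S (A * B) := by
  obtain ⟨M, hM⟩ := hA
  obtain ⟨N, hN⟩ := hB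
  obtain ⟨M', hM'⟩ := hA'
  obtain ⟨N', hN'⟩ := hB'
  refine ⟨M' * N' + M * ‖B‖ + ‖A‖ * N, fun t => ?_⟩
  have e : S.map t (A * B) - A * B = defect (S.map t) (Star.star A) B
      + (S.map t A - A) * S.map t B + A * (S.map t B - B) := by
    rw [defect, map_star_eq, star_star, star_star]
    noncomm_ring
  have b₁ : ‖defect (S.map t) (Star.star A) B‖ ≤ (M' * √t) * (N' * √t) :=
    (norm_defect_le _ (S.map_one t) _ _).trans <|
      mul_le_mul (hM' t) (hN' t) (Real.sqrt_nonneg _) ((Real.sqrt_nonneg _).trans (hM' t))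
  have b₂ : ‖(S.map t A - A) * S.map t B‖ ≤ M * t * ‖B‖ := (norm_mul_le _ _).trans <|
    mul_le_mul (hM t) (norm_map_le _ (S.map_one t) _) (norm_nonneg _)
      ((norm_nonneg _).trans (hM t))
  have b₃ : ‖A * (S.map t B - B)‖ ≤ ‖A‖ * (N * t) := (norm_mul_le _ _).trans <| by
    gcongr; exact hN t
  have hs : √(t : ℝ) * √t = t := Real.mul_self_sqrt t.coe_nonneg
  rw [e]
  refine norm_add₃_le.trans ?_
  have : (M' * √t) * (N' * √t) = M' * N' * t := by linear_combination M' * N' * hs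
  linarith

/-- A partial converse: the same expansion, solved for the defect of `A` with itself. -/
lemma HasLipschitzOrbit.hasLinearDefect (hA : HasLipschitzOrbit S A)
    (hA' : HasLipschitzOrbit S (Star.star A * A)) : HasLinearDefect S A := by
  obtain ⟨M, hM⟩ := hA
  obtain ⟨N, hN⟩ := hA'
  refine ⟨√(N + 2 * ‖A‖ * M), fun t => ?_⟩
  rw [← Real.sqrt_mul' _ t.coe_nonneg]
  refine Real.sqrt_le_sqrt ?_
  have e : defect (S.map t) A A = (S.map t (Star.star A * A) - Star.star A * A)
      - Star.star (S.map t A - A) * S.map t A - Star.star A * (S.map t A - A) := by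
    rw [defect, star_sub]
    noncomm_ring
  have b₂ : ‖Star.star (S.map t A - A) * S.map t A‖ ≤ M * t * ‖A‖ := (norm_mul_le _ _).trans <| by
    rw [norm_star]
    exact mul_le_mul (hM t) (norm_map_le _ (S.map_one t) _) (norm_nonneg _)
      ((norm_nonneg _).trans (hM t))
  have b₃ : ‖Star.star A * (S.map t A - A)‖ ≤ ‖A‖ * (M * t) := (norm_mul_le _ _).trans <| by
    rw [norm_star]; gcongr; exact hM t
  rw [e]
  refine (norm_sub_le _ _).trans ?_
  linarith [norm_sub_le (S.map t (Star.star A * A) - Star.star A * A)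
    (Star.star (S.map t A - A) * S.map t A), hN t]

lemma HasLinearDefect.add (hA : HasLinearDefect S A) (hB : HasLinearDefect S B) :
    HasLinearDefect S (A + B) := by
  obtain ⟨M, hM⟩ := hA
  obtain ⟨N, hN⟩ := hB
  refine ⟨M + N, fun t => ?_⟩
  linarith [hM t, hN t, defectNorm_add_le (S.map t) (S.map_one t) A B]

lemma HasLinearDefect.mul (hA : HasLinearDefect S A) (hB : HasLinearDefect S B) :
    HasLinearDefect S (A * B) := by
  obtain ⟨M, hM⟩ := hA
  obtain ⟨N, hN⟩ := hB
  refine ⟨M * ‖B‖ + 3 * ‖A‖ * N, fun t => ?_⟩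
  calc _ ≤ defectNorm (S.map t) A * ‖B‖ + 3 * ‖A‖ * defectNorm (S.map t) B :=
        defectNorm_mul_le (S.map t) (S.map_one t) A B
    _ ≤ M * √t * ‖B‖ + 3 * ‖A‖ * (N * √t) := by gcongr; exacts [hM t, hN t]
    _ = _ := by ring

lemma hasLinearDefect_algebraMap (S : QuantumMarkovSemigroup H) (c : ℂ) :
    HasLinearDefect S (algebraMap ℂ _ c) :=
  ⟨0, fun t => by simp [defectNorm_algebraMap (S.map t) (S.map_one t) c]⟩

lemma hasLipschitzOrbit_algebraMap (S : QuantumMarkovSemigroup H) (c : ℂ) :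
    HasLipschitzOrbit S (algebraMap ℂ _ c) :=
  ⟨0, fun t => by simp [Algebra.algebraMap_eq_smul_one, S.map_one t]⟩

end

/-- The operators in the domain of the generator whose defect, and that of their adjoint, is of
order `t`. They form a `*`-algebra. -/
def linearDefectAlgebra (S : QuantumMarkovSemigroup H) : StarSubalgebra ℂ (H →L[ℂ] H) where
  carrier := {A | A ∈ (generator S).domain ∧ HasLinearDefect S A ∧ HasLinearDefect S (star A)}
  mul_mem' := by
    rintro A B ⟨hA, hA', hA''⟩ ⟨hB, hB', hB''⟩
    refine ⟨?_, hA'.mul hB', by rw [star_mul]; exact hB''.mul hA''⟩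
    rw [mem_domain_iff_hasLipschitzOrbit] at hA hB ⊢
    exact hA.mul hB hA'' hB'
  add_mem' := by
    rintro A B ⟨hA, hA', hA''⟩ ⟨hB, hB', hB''⟩
    exact ⟨add_mem hA hB, hA'.add hB', by rw [star_add]; exact hA''.add hB''⟩
  algebraMap_mem' c := by
    refine ⟨mem_domain_iff_hasLipschitzOrbit.mpr (hasLipschitzOrbit_algebraMap S c),
      hasLinearDefect_algebraMap S c, ?_⟩
    rw [← algebraMap_star_comm]
    exact hasLinearDefect_algebraMap S _
  star_mem' := by
    rintro A ⟨hA, hA', hA''⟩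
    rw [mem_domain_iff_hasLipschitzOrbit] at hA
    exact ⟨mem_domain_iff_hasLipschitzOrbit.mpr hA.star, hA'', by rwa [star_star]⟩

/-- A `*`-subalgebra of the domain contains `X* X` along with `X`, which forces a linear defect. All
such subalgebras thus lie in one `*`-algebra inside the domain, and so does their supremum. -/
lemma domainAlgebra_le (S : QuantumMarkovSemigroup H) :
    domainAlgebra S ≤ linearDefectAlgebra S := by
  refine sSup_le fun B hB A hA => ?_
  have hlip : ∀ X ∈ B, HasLipschitzOrbit S X := fun X hX =>
    mem_domain_iff_hasLipschitzOrbit.mp (hB hX)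
  have hdef : ∀ X ∈ B, HasLinearDefect S X := fun X hX =>
    (hlip X hX).hasLinearDefect (hlip _ (mul_mem (star_mem hX) hX))
  exact ⟨hB hA, hdef A hA, hdef _ (star_mem hA)⟩

/-- The domain algebra is contained in the domain of the generator. -/
theorem mem_domain_of_mem_domainAlgebra (S : QuantumMarkovSemigroup H) (A : H →L[ℂ] H)
    (hA : A ∈ domainAlgebra S) : A ∈ (generator S).domain :=
  (domainAlgebra_le S hA).1

end DomainAlgebra

/-! ### Drift and jump part of a generator, and their approximation by difference quotients. -/

section JumpForm

open scoped ComplexConjugate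
open InnerProductSpace (rankOne)

variable {H : Type u} [NormedAddCommGroup H] [InnerProductSpace ℂ H]

/-- The drift vector at `v`, with respect to the unit vector `e`, of a map `D` of the bounded
operators. -/
def drift (D : (H →L[ℂ] H) → (H →L[ℂ] H)) (e v : H) : H :=
  D (rankOne ℂ v e) e - (((⟪e, D (rankOne ℂ e e) e⟫_ℂ).re / 2 : ℝ) : ℂ) • v

lemma drift_smul (D : (H →L[ℂ] H) → (H →L[ℂ] H)) (e v : H) (c : ℝ) :
    drift (fun A => (c : ℂ) • D A) e v = (c : ℂ) • drift D e v := by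
  simp only [drift, smul_apply, inner_smul_right, Complex.re_ofReal_mul, smul_sub, smul_smul]
  congr 2
  push_cast
  ring

variable [CompleteSpace H]

/-- What remains of the form of `D A` when the drift is removed. -/
def jumpForm (D : (H →L[ℂ] H) → (H →L[ℂ] H)) (e : H) (A : H →L[ℂ] H) (u w : H) : ℂ :=
  ⟪u, D A w⟫_ℂ - ⟪u, drift D e (A w)⟫_ℂ - ⟪drift D e (star A u), w⟫_ℂ

/-- For a unital completely positive `φ`, the jump form of `φ - id` is a dilated form. -/
lemma exists_dilation_jumpForm_sub (φ : (H →L[ℂ] H) →CP (H →L[ℂ] H)) (hφ : φ 1 = 1) {e : H}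
    (he : ‖e‖ = 1) :
    ∃ (K : Type u) (_ : NormedAddCommGroup K) (_ : InnerProductSpace ℂ K) (_ : CompleteSpace K)
      (π : (H →L[ℂ] H) →⋆ₐ[ℂ] (K →L[ℂ] K)) (W : H →ₗ[ℂ] K),
      (∀ A, ‖π A‖ ≤ ‖A‖) ∧
      ∀ A u w, jumpForm (fun A => φ A - A) e A u w = ⟪W u, π A (W w)⟫_ℂ := by
  obtain ⟨K, i₁, i₂, i₃, π, V, hπ, hV, hφV⟩ := exists_stinespring_of_map_one φ hφ
  have hπstar := inner_representation_left π
  have hφstar : ∀ A x y, ⟪φ A x, y⟫_ℂ = ⟪x, φ (star A) y⟫_ℂ := fun A x y => by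
    rw [map_star_eq, ContinuousLinearMap.star_eq_adjoint, ContinuousLinearMap.adjoint_inner_right]
  -- Expanding `⟪W u, π(A) W w⟫` yields `⟪u, φ(A) w⟫`, two cross terms that the drift removes, and
  -- `⟪u, A w⟫ p`. The term `½ Re` in `drift` is chosen to match the last one, half from each side.
  let W : H →ₗ[ℂ] K :=
    { toFun := fun u => V u - π (rankOne ℂ u e) (V e)
      map_add' := fun u w => by simp only [map_add, add_apply]; abel
      map_smul' := fun c u => by
        simp only [map_smul, smul_apply, smul_sub, RingHom.id_apply] }
  have hW : ∀ u, W u = V u - π (rankOne ℂ u e) (V e) := fun _ => rfl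
  refine ⟨K, i₁, i₂, i₃, π, W, hπ, fun A u w => ?_⟩
  have hee : ⟪e, e⟫_ℂ = 1 := by simp [inner_self_eq_norm_sq_to_K, he]
  have hstar : ∀ x y : H, star (rankOne ℂ x y : H →L[ℂ] H) = rankOne ℂ y x := fun x y => by
    simp [ContinuousLinearMap.star_eq_adjoint]
  set p := ⟪e, φ (rankOne ℂ e e) e⟫_ℂ with hp
  have hpre : (p.re : ℂ) = p := by
    refine Complex.conj_eq_iff_re.mp ?_
    rw [hp, inner_conj_symm, hφstar, hstar]
  have hPe : ⟪e, (rankOne ℂ e e : H →L[ℂ] H) e⟫_ℂ = 1 := by simp [he]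
  have hA : ⟪star A u, w⟫_ℂ = ⟪u, A w⟫_ℂ := by
    rw [ContinuousLinearMap.star_eq_adjoint, ContinuousLinearMap.adjoint_inner_left]
  have hdrift : ∀ v, drift (fun A => φ A - A) e v
      = φ (rankOne ℂ v e) e - (1 / 2 : ℂ) • v - (p / 2) • v := fun v => by
    have : ((((⟪e, (φ (rankOne ℂ e e) - rankOne ℂ e e) e⟫_ℂ).re / 2 : ℝ)) : ℂ) = p / 2 - 1 / 2 := by
      rw [sub_apply, inner_sub_right, hPe, ← hp]
      push_cast [Complex.sub_re]
      rw [hpre]; simp; ring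
    rw [drift, this]
    have : (rankOne ℂ v e : H →L[ℂ] H) e = v := by simp [he]
    rw [sub_apply, this]
    module
  have m₁ : A * rankOne ℂ w e = rankOne ℂ (A w) e := by ext z; simp
  have m₂ : rankOne ℂ e u * A = star (rankOne ℂ (star A u) e : H →L[ℂ] H) := by
    rw [hstar]; ext z; simp [ContinuousLinearMap.star_eq_adjoint,
      ContinuousLinearMap.adjoint_inner_left]
  have m₃ : rankOne ℂ e u * A * rankOne ℂ w e = ⟪u, A w⟫_ℂ • (rankOne ℂ e e : H →L[ℂ] H) := by
    ext z; simp [smul_smul, mul_comm]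
  have e₁ : ⟪V u, π A (π (rankOne ℂ w e) (V e))⟫_ℂ = ⟪u, φ (rankOne ℂ (A w) e) e⟫_ℂ := by
    rw [hφV, ← m₁, map_mul, mul_apply_eq_comp]
  have e₂ : ⟪π (rankOne ℂ u e) (V e), π A (V w)⟫_ℂ = ⟪φ (rankOne ℂ (star A u) e) e, w⟫_ℂ := by
    rw [hφstar, hφV, ← m₂, hπstar, hstar, map_mul, mul_apply_eq_comp]
  have e₃ : ⟪π (rankOne ℂ u e) (V e), π A (π (rankOne ℂ w e) (V e))⟫_ℂ = ⟪u, A w⟫_ℂ * p := by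
    rw [hπstar, hstar, ← mul_apply_eq_comp, ← mul_apply_eq_comp, ← map_mul, ← map_mul,
      m₃, map_smul, smul_apply, inner_smul_right, ← hφV]
  rw [jumpForm, hdrift, hdrift, hW, hW]
  simp only [map_sub, sub_apply, inner_sub_left, inner_sub_right, inner_smul_left,
    inner_smul_right, hA, e₁, e₂, e₃, ← hφV]
  have hpc : conj p = p := Complex.conj_eq_iff_re.mpr hpre
  simp only [map_div₀, hpc, map_one, map_ofNat]
  ring

lemma jumpForm_smul (D : (H →L[ℂ] H) → (H →L[ℂ] H)) (e : H) (c : ℝ) (A : H →L[ℂ] H) (u w : H) :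
    jumpForm (fun A => (c : ℂ) • D A) e A u w = c * jumpForm D e A u w := by
  simp only [jumpForm, drift_smul, smul_apply, inner_smul_right, inner_smul_left,
    Complex.conj_ofReal]
  ring

lemma exists_dilation_jumpForm_diffQuot (S : QuantumMarkovSemigroup H) (t : ℝ≥0) {e : H}
    (he : ‖e‖ = 1) :
    ∃ (K : Type u) (_ : NormedAddCommGroup K) (_ : InnerProductSpace ℂ K) (_ : CompleteSpace K)
      (π : (H →L[ℂ] H) →⋆ₐ[ℂ] (K →L[ℂ] K)) (W : H →ₗ[ℂ] K),
      (∀ A, ‖π A‖ ≤ ‖A‖) ∧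
      ∀ A u w, jumpForm (fun A => diffQuot S A t) e A u w = ⟪W u, π A (W w)⟫_ℂ := by
  obtain ⟨K, i₁, i₂, i₃, π, W, hπ, hW⟩ := exists_dilation_jumpForm_sub (S.map t) (S.map_one t) he
  -- The factor `t⁻¹` is split evenly over the two slots. At `t = 0` both sides vanish.
  refine ⟨K, i₁, i₂, i₃, π, ((√((t : ℝ)⁻¹) : ℝ) : ℂ) • W, hπ, fun A u w => ?_⟩
  have hs : (((√((t : ℝ)⁻¹) : ℝ) : ℂ)) * ((√((t : ℝ)⁻¹) : ℝ) : ℂ) = (((t : ℝ)⁻¹ : ℝ) : ℂ) := by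
    rw [← Complex.ofReal_mul, Real.mul_self_sqrt (inv_nonneg.mpr t.coe_nonneg)]
  have hd : (fun A => diffQuot S A t) = fun A => (((t : ℝ)⁻¹ : ℝ) : ℂ) • (S.map t A - A) := by
    funext A
    rw [diffQuot, Complex.ofReal_inv]
  rw [hd, jumpForm_smul (fun A => S.map t A - A), hW, LinearMap.smul_apply, LinearMap.smul_apply,
    map_smul, inner_smul_left, inner_smul_right, Complex.conj_ofReal, ← mul_assoc, hs]

lemma jumpForm_diffQuot_star (S : QuantumMarkovSemigroup H) (t : ℝ≥0) {e : H} (he : ‖e‖ = 1)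
    (A : H →L[ℂ] H) (u w : H) :
    jumpForm (fun A => diffQuot S A t) e (star A) u w
      = conj (jumpForm (fun A => diffQuot S A t) e A w u) := by
  obtain ⟨K, i₁, i₂, i₃, π, W, hπ, hW⟩ := exists_dilation_jumpForm_diffQuot S t he
  rw [hW, hW, inner_conj_symm, inner_representation_left]

lemma sum_inner_representation {ι K : Type*} [NormedAddCommGroup K] [InnerProductSpace ℂ K]
    [CompleteSpace K] (π : (H →L[ℂ] H) →⋆ₐ[ℂ] (K →L[ℂ] K)) (W : H →ₗ[ℂ] K)
    (s : Finset ι) (A : ι → H →L[ℂ] H) (x : ι → H) :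
    ∑ j ∈ s, ∑ i ∈ s, ⟪W (x i), π (star (A i) * A j) (W (x j))⟫_ℂ
      = ((‖∑ i ∈ s, π (A i) (W (x i))‖ ^ 2 : ℝ) : ℂ) := by
  have h := inner_self_eq_norm_sq_to_K (𝕜 := ℂ) (∑ i ∈ s, π (A i) (W (x i)))
  rw [Complex.ofReal_pow]
  refine Eq.trans ?_ h
  rw [inner_sum]
  refine Finset.sum_congr rfl fun j _ => ?_
  rw [sum_inner]
  refine Finset.sum_congr rfl fun i _ => ?_
  rw [inner_representation_left, map_mul, mul_apply_eq_comp]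

lemma sum_jumpForm_diffQuot_nonneg (S : QuantumMarkovSemigroup H) (t : ℝ≥0) {e : H} (he : ‖e‖ = 1)
    {ι : Type*} (s : Finset ι) (A : ι → H →L[ℂ] H) (x : ι → H) :
    0 ≤ (∑ j ∈ s, ∑ i ∈ s,
      jumpForm (fun A => diffQuot S A t) e (star (A i) * A j) (x i) (x j)).re := by
  obtain ⟨K, i₁, i₂, i₃, π, W, hπ, hW⟩ := exists_dilation_jumpForm_diffQuot S t he
  simp only [hW]
  rw [sum_inner_representation, Complex.ofReal_re]
  positivity

/-- Both sums are squared norms, of `π(B) ξ` and of `ξ = ∑ᵢ π(Aᵢ) W xᵢ`. This uniform bound is what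
makes the limiting representation contractive. -/
lemma sum_jumpForm_diffQuot_le (S : QuantumMarkovSemigroup H) (t : ℝ≥0) {e : H} (he : ‖e‖ = 1)
    {ι : Type*} (B : H →L[ℂ] H) (s : Finset ι) (A : ι → H →L[ℂ] H) (x : ι → H) :
    (∑ j ∈ s, ∑ i ∈ s,
      jumpForm (fun A => diffQuot S A t) e (star (B * A i) * (B * A j)) (x i) (x j)).re
    ≤ ‖B‖ ^ 2 * (∑ j ∈ s, ∑ i ∈ s,
      jumpForm (fun A => diffQuot S A t) e (star (A i) * A j) (x i) (x j)).re := by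
  obtain ⟨K, i₁, i₂, i₃, π, W, hπ, hW⟩ := exists_dilation_jumpForm_diffQuot S t he
  simp only [hW]
  rw [sum_inner_representation π W s (fun i => B * A i) x, sum_inner_representation,
    Complex.ofReal_re, Complex.ofReal_re, ← mul_pow]
  have : ∑ i ∈ s, π (B * A i) (W (x i)) = π B (∑ i ∈ s, π (A i) (W (x i))) := by
    simp only [map_mul, mul_apply_eq_comp, map_sum]
  rw [this]
  gcongr
  exact (π B).le_of_opNorm_le (hπ B) _

lemma tendsto_drift {S : QuantumMarkovSemigroup H} {D : (H →L[ℂ] H) → (H →L[ℂ] H)} {e v : H}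
    (he : IsGeneratorAt S (rankOne ℂ e e) (D (rankOne ℂ e e)))
    (hv : IsGeneratorAt S (rankOne ℂ v e) (D (rankOne ℂ v e))) (u : H) :
    Tendsto (fun t => ⟪u, drift (fun A => diffQuot S A t) e v⟫_ℂ) (𝓝[≠] 0)
      (𝓝 ⟪u, drift D e v⟫_ℂ) := by
  simp only [drift, inner_sub_right, inner_smul_right]
  refine (TendstoSigmaWeak.inner hv u e).sub (Tendsto.mul_const _ ?_)
  exact (Complex.continuous_ofReal.tendsto _).comp
    (((Complex.continuous_re.tendsto _).comp (TendstoSigmaWeak.inner he e e)).div_const 2)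

lemma tendsto_jumpForm {S : QuantumMarkovSemigroup H} {D : (H →L[ℂ] H) → (H →L[ℂ] H)} {e : H}
    {A : H →L[ℂ] H} {u w : H}
    (he : IsGeneratorAt S (rankOne ℂ e e) (D (rankOne ℂ e e))) (hA : IsGeneratorAt S A (D A))
    (hw : IsGeneratorAt S (rankOne ℂ (A w) e) (D (rankOne ℂ (A w) e)))
    (hu : IsGeneratorAt S (rankOne ℂ (star A u) e) (D (rankOne ℂ (star A u) e))) :
    Tendsto (fun t => jumpForm (fun A => diffQuot S A t) e A u w) (𝓝[≠] 0)
      (𝓝 (jumpForm D e A u w)) := by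
  refine ((TendstoSigmaWeak.inner hA u w).sub (tendsto_drift he hw u)).sub ?_
  have := (Complex.continuous_conj.tendsto _).comp (tendsto_drift he hu w)
  simpa only [Function.comp_def, inner_conj_symm] using this

end JumpForm

/-! ### Passage to the limit and the Lindblad form. -/

section Lindblad

open scoped ComplexConjugate
open InnerProductSpace (rankOne)

variable {H : Type u} [NormedAddCommGroup H] [InnerProductSpace ℂ H]

/-- The component of `T h` along any `k'ₛ` is `t'ₛ t⁻¹ √t`, which is positive. -/
lemma IsAssociateVector.apply_ne_zero {T : H →L[ℂ] H} {h : H} (hh : IsAssociateVector T h) :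
    T h ≠ 0 := by
  obtain ⟨m, t', k', k, hm, ht', hk', rfl, hk, rfl⟩ := hh
  let s₀ : Fin m := ⟨0, hm⟩
  have ht : 0 < ∑ r, t' r := Finset.sum_pos (fun r _ => ht' r) ⟨s₀, Finset.mem_univ _⟩
  have hks : ∀ s, ‖k s‖ ^ 2 = ∑ r, t' r := fun s => by
    rw [hk, norm_smul, hk'.1 s, mul_one, Complex.norm_real, Real.norm_of_nonneg (Real.sqrt_nonneg _),
      Real.sq_sqrt ht.le]
  have hort := orthonormal_iff_ite.mp hk'
  have hT : ∀ z, ⟪k' s₀, (∑ s, (t' s : ℂ) • rankOne ℂ (k' s) (k' s) : H →L[ℂ] H) z⟫_ℂ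
      = t' s₀ * ⟪k' s₀, z⟫_ℂ := fun z => by
    simp [hort]
  have hz : ⟪k' s₀, ∑ s, ((‖k s‖ ^ 2)⁻¹ : ℂ) • k s⟫_ℂ
      = ((∑ r, t' r : ℝ) : ℂ)⁻¹ * (√(∑ r, t' r) : ℂ) := by
    have hks' : ∀ s, (‖k s‖ : ℂ) ^ 2 = ((∑ r, t' r : ℝ) : ℂ) := fun s => by
      rw [← hks s, Complex.ofReal_pow]
    simp only [inner_sum, inner_smul_right, hks']
    simp only [hk, inner_smul_right, hort]
    simp
  intro h0
  have h1 := hT (∑ s, ((‖k s‖ ^ 2)⁻¹ : ℂ) • k s)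
  rw [h0, inner_zero_right, hz] at h1
  have h2 : ((t' s₀ : ℝ) : ℂ) ≠ 0 := by exact_mod_cast (ht' s₀).ne'
  have h3 : ((∑ r, t' r : ℝ) : ℂ) ≠ 0 := by exact_mod_cast ht.ne'
  have h4 : ((√(∑ r, t' r) : ℝ) : ℂ) ≠ 0 := by exact_mod_cast (Real.sqrt_pos.mpr ht).ne'
  exact mul_ne_zero h2 (mul_ne_zero (inv_ne_zero h3) h4) h1.symm

variable [CompleteSpace H]

/-- The action of `𝒜` on the invariant subspace `{x | |x⟩⟨y| ∈ 𝒜}`, as a bilinear map. -/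
def actₗ (𝒜 : StarSubalgebra ℂ (H →L[ℂ] H)) (y : H) :
    𝒜 →ₗ[ℂ] rankOneSubspace 𝒜 y →ₗ[ℂ] rankOneSubspace 𝒜 y :=
  LinearMap.mk₂ ℂ act (fun A B x => Subtype.ext (by simp [act]))
    (fun c A x => Subtype.ext (by simp [act])) (fun A x z => Subtype.ext (by simp [act]))
    (fun c A x => Subtype.ext (by simp [act]))

/-- A `*`-algebra in the domain of the generator admits a Lindblad-type decomposition of the
generator on the subspace `{x | |x⟩⟨y| ∈ 𝒜}`, once there is a unit vector `e` with `|e⟩⟨e|` in the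
domain and `|x⟩⟨e| ∈ 𝒜` for all `x` in the subspace. -/
theorem exists_lindblad_form (S : QuantumMarkovSemigroup H) (𝒜 : StarSubalgebra ℂ (H →L[ℂ] H))
    (hdom : ∀ A ∈ 𝒜, A ∈ (generator S).domain) (y : H) {e : H} (he : ‖e‖ = 1)
    (hee : rankOne ℂ e e ∈ (generator S).domain)
    (hU : ∀ x ∈ rankOneSubspace 𝒜 y, (rankOne ℂ x e : H →L[ℂ] H) ∈ 𝒜) :
    ∃ (K : Type u) (_ : NormedAddCommGroup K) (_ : InnerProductSpace ℂ K) (_ : CompleteSpace K)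
      (π : 𝒜 →⋆ₐ[ℂ] (K →L[ℂ] K)) (G : rankOneSubspace 𝒜 y →ₗ[ℂ] H)
      (V : rankOneSubspace 𝒜 y →ₗ[ℂ] K), Continuous π ∧
      ∀ (u w : rankOneSubspace 𝒜 y) (A : 𝒜),
        ⟪(u : H), generator S ⟨A, hdom A A.2⟩ (w : H)⟫_ℂ
          = ⟪V u, π A (V w)⟫_ℂ + ⟪(u : H), G (act A w)⟫_ℂ + ⟪G (act (star A) u), (w : H)⟫_ℂ := by
  classical
  -- A total version of the generator, `0` off the domain, so that `drift` and `jumpForm` apply. It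
  -- is linear only on the domain, hence the membership hypotheses below.
  let D : (H →L[ℂ] H) → (H →L[ℂ] H) := fun A =>
    if hA : A ∈ (generator S).domain then generator S ⟨A, hA⟩ else 0
  have hDdom : ∀ A (hA : A ∈ (generator S).domain), D A = generator S ⟨A, hA⟩ := fun A hA =>
    dif_pos hA
  have hD : ∀ A ∈ (generator S).domain, IsGeneratorAt S A (D A) := fun A hA => by
    rw [hDdom A hA]; exact generator_spec S ⟨A, hA⟩
  have hDadd : ∀ A B, A ∈ (generator S).domain → B ∈ (generator S).domain →
      D (A + B) = D A + D B := fun A B hA hB =>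
    (hD _ (add_mem hA hB)).unique ((hD A hA).add (hD B hB))
  have hDsmul : ∀ (c : ℂ) A, A ∈ (generator S).domain → D (c • A) = c • D A := fun c A hA =>
    (hD _ (Submodule.smul_mem _ c hA)).unique ((hD A hA).smul c)
  let G : rankOneSubspace 𝒜 y →ₗ[ℂ] H :=
    { toFun := fun u => drift D e u
      map_add' := fun u w => by
        simp only [drift, Submodule.coe_add, map_add, add_apply,
          hDadd _ _ (hdom _ (hU u u.2)) (hdom _ (hU w w.2)), smul_add]
        abel
      map_smul' := fun c u => by
        simp only [drift, Submodule.coe_smul, map_smul, smul_apply,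
          hDsmul c _ (hdom _ (hU u u.2)), smul_sub, RingHom.id_apply]
        rw [smul_comm c] }
  let β : 𝒜 →ₗ[ℂ] rankOneSubspace 𝒜 y →ₗ⋆[ℂ] rankOneSubspace 𝒜 y →ₗ[ℂ] ℂ :=
    { toFun := fun A => LinearMap.mk₂'ₛₗ (starRingEnd ℂ) (RingHom.id ℂ)
        (fun u w => ⟪(u : H), D A (w : H)⟫_ℂ - ⟪(u : H), G (actₗ 𝒜 y A w)⟫_ℂ
          - ⟪G (actₗ 𝒜 y (star A) u), (w : H)⟫_ℂ)
        (fun u u' w => by simp only [map_add, Submodule.coe_add, inner_add_left]; ring)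
        (fun c u w => by
          simp only [map_smul, Submodule.coe_smul, inner_smul_left, smul_eq_mul]; ring)
        (fun u w w' => by simp only [map_add, Submodule.coe_add, inner_add_right]; ring)
        (fun c u w => by
          simp only [map_smul, Submodule.coe_smul, inner_smul_right, smul_eq_mul,
            RingHom.id_apply]
          ring)
      map_add' := fun A B => by
        ext u w
        simp only [LinearMap.mk₂'ₛₗ_apply, LinearMap.add_apply, map_add, star_add,
          AddMemClass.coe_add, hDadd _ _ (hdom A A.2) (hdom B B.2),
          add_apply, inner_add_left, inner_add_right]
        ring
      map_smul' := fun c A => by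
        ext u w
        simp only [LinearMap.mk₂'ₛₗ_apply, LinearMap.smul_apply, map_smul, star_smul,
          SetLike.val_smul, hDsmul c _ (hdom A A.2), smul_apply, inner_smul_left,
          inner_smul_right, RCLike.star_def, RCLike.conj_conj, RingHom.id_apply, smul_eq_mul]
        ring }
  have hβ : ∀ (A : 𝒜) u w, β A u w = jumpForm D e A u w := fun _ _ _ => rfl
  have hlim : ∀ (A : 𝒜) (u w : rankOneSubspace 𝒜 y),
      Tendsto (fun t => jumpForm (fun A => diffQuot S A t) e A u w) (𝓝[≠] 0) (𝓝 (β A u w)) :=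
    fun A u w => by
      rw [hβ]
      exact tendsto_jumpForm (hD _ hee) (hD _ (hdom A A.2))
        (hD _ (hdom _ (hU _ (act A w).2))) (hD _ (hdom _ (hU _ (act (star A) u).2)))
  have hlimsum : ∀ (s : Finset (𝒜 × rankOneSubspace 𝒜 y)) (F : 𝒜 → 𝒜),
      Tendsto (fun t => (∑ q ∈ s, ∑ p ∈ s, jumpForm (fun A => diffQuot S A t) e
        (star (F p.1 : H →L[ℂ] H) * F q.1) p.2 q.2).re) (𝓝[≠] 0)
        (𝓝 (∑ q ∈ s, ∑ p ∈ s, β (star (F p.1) * F q.1) p.2 q.2).re) := fun s F =>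
    (Complex.continuous_re.tendsto _).comp
      (tendsto_finsetSum _ fun q _ => tendsto_finsetSum _ fun p _ =>
        hlim (star (F p.1) * F q.1) p.2 q.2)
  -- Hermitian symmetry, positivity and boundedness hold for each `t` and survive `t → 0`.
  obtain ⟨K, i₁, i₂, i₃, π, V, hπ, hV⟩ := exists_dilation β
    (fun A u w => tendsto_nhds_unique (hlim (star A) u w) <|
      ((Complex.continuous_conj.tendsto _).comp (hlim A w u)).congr fun t =>
        (jumpForm_diffQuot_star S t he A u w).symm)
    (fun s => ge_of_tendsto' (hlimsum s id) fun t =>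
      sum_jumpForm_diffQuot_nonneg S t he s (fun p => (p.1 : H →L[ℂ] H)) fun p => (p.2 : H))
    (fun A s => le_of_tendsto_of_tendsto' (hlimsum s fun B => A * B)
      ((hlimsum s id).const_mul (‖A‖ ^ 2)) fun t =>
      sum_jumpForm_diffQuot_le S t he A s (fun p => (p.1 : H →L[ℂ] H)) fun p => (p.2 : H))
  refine ⟨K, i₁, i₂, i₃, π, G, V,
    AddMonoidHomClass.continuous_of_bound π 1 fun A => by rw [one_mul]; exact hπ A,
    fun u w A => ?_⟩
  rw [← hV, ← hDdom A (hdom A A.2)]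
  change _ = (⟪(u : H), D A (w : H)⟫_ℂ - ⟪(u : H), G (act A w)⟫_ℂ
          - ⟪G (act (star A) u), (w : H)⟫_ℂ) + _ + _
  ring

end Lindblad

end QMS

end

theorem corollary3p7 {H : Type u} [NormedAddCommGroup H] [InnerProductSpace ℂ H] [CompleteSpace H]
    (S : QMS.QuantumMarkovSemigroup H)
    (T : H →L[ℂ] H) (hTpos : T.IsPositive) (hTfin : FiniteDimensional ℂ T.range)
    (hTdom : T ∈ (QMS.generator S).domain)
    (h : H) (hh : QMS.IsAssociateVector T h)
    (hThdom : InnerProductSpace.rankOne ℂ (T h) (T h) ∈ (QMS.generator S).domain) :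
    ∃ hdom : ∀ A ∈ QMS.domainAlgebra S, A ∈ (QMS.generator S).domain,
    ∃ (K : Type u) (_ : NormedAddCommGroup K) (_ : InnerProductSpace ℂ K) (_ : CompleteSpace K)
      (π : QMS.domainAlgebra S →⋆ₐ[ℂ] (K →L[ℂ] K))
      (G : QMS.rankOneSubspace (QMS.domainAlgebra S) (T h) →ₗ[ℂ] H)
      (V : QMS.rankOneSubspace (QMS.domainAlgebra S) (T h) →ₗ[ℂ] K),
      Continuous π ∧
      ∀ (u w : QMS.rankOneSubspace (QMS.domainAlgebra S) (T h)) (A : QMS.domainAlgebra S),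
        ⟪(u : H), QMS.generator S ⟨A, hdom A A.2⟩ (w : H)⟫_ℂ
          = ⟪V u, π A (V w)⟫_ℂ + ⟪(u : H), G (QMS.act A w)⟫_ℂ
            + ⟪G (QMS.act (star A) u), (w : H)⟫_ℂ := by
  have hdom := QMS.mem_domain_of_mem_domainAlgebra S
  have hne := hh.apply_ne_zero
  -- Operators `|x⟩⟨e|` are scalar multiples of `|x⟩⟨T h|`, so normalising preserves every
  -- membership in `𝒜` or in the domain.
  let e : H := ((‖T h‖ : ℂ)⁻¹) • T h
  have hrank : ∀ x : H, InnerProductSpace.rankOne ℂ x e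
      = ((‖T h‖ : ℂ)⁻¹) • (InnerProductSpace.rankOne ℂ x (T h) : H →L[ℂ] H) := fun x => by
    ext z
    simp [e, smul_smul]
  refine ⟨hdom, QMS.exists_lindblad_form S (QMS.domainAlgebra S) hdom (T h) (e := e)
    (norm_smul_inv_norm hne) ?_ fun x hx => ?_⟩
  · rw [hrank]
    refine Submodule.smul_mem _ _ ?_
    have : (InnerProductSpace.rankOne ℂ e (T h) : H →L[ℂ] H)
        = ((‖T h‖ : ℂ)⁻¹) • InnerProductSpace.rankOne ℂ (T h) (T h) := by
      simp [e]
    rw [this]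
    exact Submodule.smul_mem _ _ hThdom
  · rw [hrank]
    exact SMulMemClass.smul_mem _ hx
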